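/- **Setting.** Let $\mathcal G$ be a weighted directed graph on the nodes $1,\dots,n$ without self-loops, with weights $a_{ij}\ge 0$, where $a_{ij}>0$ iff there is an edge from $j$ to $i$. Let $d_i=\sum_j a_{ij}$, let $L=\mathrm{diag}(d_1,\dots,d_n)-[a_{ij}]$, and fix $\alpha>0$ with $\alpha d_i<1$ for all $i$, a quantization step $\Delta>0$, observations $y\in\mathbb R^n$, $\kappa\ge 0$ and starting points $k_0,t_0\in\mathbb Z_{\ge 0}$. The probabilistic quantizer $\mathcal Q(x)$ equals $\lceil x/\Delta\rceil\Delta$ with probability $p=x/\Delta-\lfloor x/\Delta\rfloor$ and $\lfloor x/\Delta\rfloor\Delta$ with probability $1-p$. *Stage 1.* $z_{ii}(0)=n^\kappa$, $z_{ij}(0)=0$ for $j\ne i$, and $z_{ij}(t+1)=z_{ij}(t)+\alpha\sum_{l}a_{il}[\mathcal Q(z_{lj}(t))-\mathcal Q(z_{ij}(t))]$; its running averages are $\bar z_{ij}(K)=\frac1K\sum_{k=k_0+1}^{k_0+K}z_{ij}(k)$. *Stage 2.* $x_i(t_0)=y_i$ and $x_i(t+1)=\hat x_i(t)+\alpha\sum_{l}a_{il}[\mathcal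 Q(\hat x_l(t))-\mathcal Q(\hat x_i(t))]$ for $t\ge t_0$, where $\hat x_i(t)=x_i(t)+\epsilon_i(t)$ with $\epsilon_i(t_0)=\bigl[\tfrac{n^{\kappa-1}}{\bar z_{ii}(t_0+1)}-1\bigr]y_i$ and $\epsilon_i(t)=\bigl[\tfrac{n^{\kappa-1}}{\bar z_{ii}(t+1)}-\tfrac{n^{\kappa-1}}{\bar z_{ii}(t)}\bigr]y_i$ for $t>t_0$; its running averages are $\bar x_i(K)=\frac1K\sum_{k=t_0+1}^{t_0+K}x_i(k)$. **Assumptions.** (1) $\mathcal G$ is strongly connected. (2) The random choices made in the quantizations are independent of each other, over all times, nodes, components and both stages ($y$ is fixed, so expectations are over the quantization only). Let $\omega$ be the left null vector of $L$ with $\mathbf 1^T\omega=1$. (3) For some $0<\eta<1$, almost surely $n^{-\kappa}\bar z_{ii}(t)\ge\eta\,\omega_i$ for all $i$ and all $t\ge t_0+1$, so that the correction terms are well defined. **Constants.** Put $Q=I-\alpha L-\mathbf 1\omega^T$, with spectral radius $\rho(Q)$, $\tilde Q=(I-Q)^{-1}Q$, $\tilde L=(I-Q)^{-1}L$, $\nu=\alpha\sqrt{n+2}\,\Delta\|\tilde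 L\|_2$, $y'=\max_i\omega_i^{-2}|y_i|$, $y''=\max_i\omega_i^{-1}|y_i|$. Let $q$ be the largest multiplicity of a nonzero eigenvalue of $Q$ in its minimal polynomial, let $c_Q$ be the least constant with $\|Q^k\|_F\le n\,c_Q\,k^{q-1}\rho(Q)^k$ for all $k\ge1$, and $c_{Q,n}^2=n+2+n^2c_Q^2\bigl(\tfrac{1-q}{e\log\rho(Q)}\bigr)^{2(q-1)}$, where the last power is $1$ if $q=1$; if $\rho(Q)=0$, put $c_{Q,n}^2=n+2$. **Theorem 4.** With $\hat\theta=\frac1n\sum_i y_i$, each $\bar x_i(K)$ is square integrable and converges to $\hat\theta$ in mean square as $K\to\infty$. Moreover $$\mathbb E\|\bar x(K)-\hat\theta\mathbf 1\|^2\le\frac{3\nu^2\bigl(n\,y''^2+2c_{Q,n}^2\,y'^2\,\|\tilde Q\|_2^2\bigr)}{n\eta^4}\,\frac{\log K}{K}+o\!\left(\frac{\log K}{K}\right)\qquad(K\to\infty).$$ -/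

import Mathlib

open Filter Topology MeasureTheory ProbabilityTheory Asymptotics

noncomputable section

namespace QuantEst

/-- A weighted directed graph without self-loops on the nodes `Fin n`. There is an edge from
`j` to `i` (node `i` receives data from node `j`) exactly when `0 < a i j`; the entry is `0`
when there is no edge. -/
structure WeightedDigraph (n : ℕ) where
  a : Matrix (Fin n) (Fin n) ℝ
  nonneg : ∀ i j, 0 ≤ a i j
  no_loop : ∀ i, a i i = 0

variable {n : ℕ}

/-- For any two nodes `i`, `j` there is a directed path from `i` to `j`. -/
def WeightedDigraph.StronglyConnected (G : WeightedDigraph n) : Prop :=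
  ∀ i j, Relation.ReflTransGen (fun p q => 0 < G.a q p) i j

/-- The in-degree `d_i`, the sum of the weights of the edges into `i`. -/
def WeightedDigraph.deg (G : WeightedDigraph n) (i : Fin n) : ℝ := ∑ j, G.a i j

/-- The Laplacian `L = D - A`. -/
def WeightedDigraph.lap (G : WeightedDigraph n) : Matrix (Fin n) (Fin n) ℝ :=
  Matrix.diagonal G.deg - G.a

/-! The quantizer and the two stages, for a given realization of the randomization. -/

/-- The probabilistic quantizer with step `Δ`, driven by a number `r` that is drawn uniformly
from `[0, 1)`: the value is `⌈x/Δ⌉Δ` if `r < p` (an event of probability `p`) and `⌊x/Δ⌋Δ`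
otherwise, where `p = x/Δ - ⌊x/Δ⌋`. -/
def quant (Δ r x : ℝ) : ℝ :=
  if r < x / Δ - ⌊x / Δ⌋ then ⌈x / Δ⌉ * Δ else ⌊x / Δ⌋ * Δ

/-- First stage: `stage1 G α Δ κ u t i j` is the `j`-th component `z_{ij}(t)` of the vector held
by node `i` at time `t`; `u t i j` drives the quantization of `z_{ij}(t)`. The sum over all nodes
`l` is the sum over the neighbours of `i`, since the other weights vanish. -/
def stage1 (G : WeightedDigraph n) (α Δ κ : ℝ) (u : ℕ → Fin n → Fin n → ℝ) :
    ℕ → Fin n → Fin n → ℝ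
  | 0 => fun i j => if i = j then (n : ℝ) ^ κ else 0
  | t + 1 => fun i j => stage1 G α Δ κ u t i j + α * ∑ l, G.a i l *
      (quant Δ (u t l j) (stage1 G α Δ κ u t l j) - quant Δ (u t i j) (stage1 G α Δ κ u t i j))

/-- The running average `z̄_{ij}(K)` of the first stage, over the times `k₀+1, …, k₀+K`. -/
def zbar (G : WeightedDigraph n) (α Δ κ : ℝ) (k₀ : ℕ) (u : ℕ → Fin n → Fin n → ℝ)
    (K : ℕ) (i j : Fin n) : ℝ :=
  (1 / (K : ℝ)) * ∑ k ∈ Finset.Icc (k₀ + 1) (k₀ + K), stage1 G α Δ κ u k i j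

/-- The correction term `ε_i(t)`, for times `t ≥ t₀`. -/
def corr (G : WeightedDigraph n) (α Δ κ : ℝ) (k₀ t₀ : ℕ) (y : Fin n → ℝ)
    (u : ℕ → Fin n → Fin n → ℝ) (t : ℕ) (i : Fin n) : ℝ :=
  if t = t₀ then ((n : ℝ) ^ (κ - 1) / zbar G α Δ κ k₀ u (t₀ + 1) i i - 1) * y i
  else ((n : ℝ) ^ (κ - 1) / zbar G α Δ κ k₀ u (t + 1) i i
    - (n : ℝ) ^ (κ - 1) / zbar G α Δ κ k₀ u t i i) * y i

/-- Second stage: `stage2 … s i` is the state `x_i(t₀ + s)`, started at `x_i(t₀) = y_i`;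
`v t i` drives the quantization of the corrected state `x_i(t) + ε_i(t)`. -/
def stage2 (G : WeightedDigraph n) (α Δ κ : ℝ) (k₀ t₀ : ℕ) (y : Fin n → ℝ)
    (u : ℕ → Fin n → Fin n → ℝ) (v : ℕ → Fin n → ℝ) : ℕ → Fin n → ℝ
  | 0 => y
  | s + 1 => fun i =>
      let xhat : Fin n → ℝ := fun l =>
        stage2 G α Δ κ k₀ t₀ y u v s l + corr G α Δ κ k₀ t₀ y u (t₀ + s) l
      xhat i + α * ∑ l, G.a i l *
        (quant Δ (v (t₀ + s) l) (xhat l) - quant Δ (v (t₀ + s) i) (xhat i))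

/-- The running average `x̄_i(K)` of the second stage, over the times `t₀+1, …, t₀+K`. -/
def xbar (G : WeightedDigraph n) (α Δ κ : ℝ) (k₀ t₀ : ℕ) (y : Fin n → ℝ)
    (u : ℕ → Fin n → Fin n → ℝ) (v : ℕ → Fin n → ℝ) (K : ℕ) (i : Fin n) : ℝ :=
  (1 / (K : ℝ)) * ∑ s ∈ Finset.Icc 1 K, stage2 G α Δ κ k₀ t₀ y u v s i

/-- The centralized sample mean. -/
def sampleMean (y : Fin n → ℝ) : ℝ := (1 / (n : ℝ)) * ∑ i, y i

/-! The constants of the bound. -/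

/-- The Euclidean operator norm of a real square matrix. -/
def norm2 (M : Matrix (Fin n) (Fin n) ℝ) : ℝ := ‖Matrix.toEuclideanCLM (n := Fin n) (𝕜 := ℝ) M‖

/-- The Frobenius norm of a real square matrix. -/
def normF (M : Matrix (Fin n) (Fin n) ℝ) : ℝ := Real.sqrt (∑ i, ∑ j, M i j ^ 2)

/-- A real matrix regarded as a complex one. -/
def toC (M : Matrix (Fin n) (Fin n) ℝ) : Matrix (Fin n) (Fin n) ℂ := M.map (fun r : ℝ => (r : ℂ))

/-- The spectral radius, the largest modulus of a complex eigenvalue. -/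
def rho (M : Matrix (Fin n) (Fin n) ℝ) : ℝ := (spectralRadius ℂ (toC M)).toReal

open scoped Classical in
/-- The largest multiplicity of a nonzero eigenvalue in the minimal polynomial (`0` if there is
no nonzero eigenvalue). -/
def qIndex (M : Matrix (Fin n) (Fin n) ℝ) : ℕ :=
  ((minpoly ℂ (toC M)).roots.toFinset.filter (fun l => l ≠ 0)).sup
    (fun l => (minpoly ℂ (toC M)).rootMultiplicity l)

/-- The least constant `c` with `‖M^k‖_F ≤ n c k^{q-1} ρ(M)^k` for all `k ≥ 1`. Such a constant
exists whenever `ρ(M) ≠ 0`; the value is `0` if there is none. -/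
def cPow (M : Matrix (Fin n) (Fin n) ℝ) : ℝ :=
  sInf {c : ℝ | 0 < c ∧ ∀ k : ℕ, 1 ≤ k →
    normF (M ^ k) ≤ n * c * (k : ℝ) ^ (qIndex M - 1) * rho M ^ k}

/-- `c_{M,n}`, the square root of `n + 2 + n² c² ((1-q)/(e log ρ(M)))^{2(q-1)}`. The last power
is `1` if `q = 1`. -/
def cPowN (M : Matrix (Fin n) (Fin n) ℝ) : ℝ :=
  Real.sqrt (n + 2 + (n : ℝ) ^ 2 * cPow M ^ 2 *
    ((1 - (qIndex M : ℝ)) / (Real.exp 1 * Real.log (rho M))) ^ (2 * (qIndex M - 1)))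

/-- `Q = I - αL - 1ωᵀ`. -/
def matQ (G : WeightedDigraph n) (α : ℝ) (ω : Fin n → ℝ) : Matrix (Fin n) (Fin n) ℝ :=
  1 - α • G.lap - Matrix.vecMulVec (fun _ => 1) ω

/-- `Q̃ = (I - Q)⁻¹ Q`. -/
def matQt (G : WeightedDigraph n) (α : ℝ) (ω : Fin n → ℝ) : Matrix (Fin n) (Fin n) ℝ :=
  (1 - matQ G α ω)⁻¹ * matQ G α ω

/-- `L̃ = (I - Q)⁻¹ L`. -/
def matLt (G : WeightedDigraph n) (α : ℝ) (ω : Fin n → ℝ) : Matrix (Fin n) (Fin n) ℝ :=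
  (1 - matQ G α ω)⁻¹ * G.lap

/-- `ν = α √(n+2) Δ ‖L̃‖₂`. -/
def nu (G : WeightedDigraph n) (α Δ : ℝ) (ω : Fin n → ℝ) : ℝ :=
  α * Real.sqrt (n + 2) * Δ * norm2 (matLt G α ω)

/-- `y' = max_i ω_i⁻² |y_i|`. -/
def y1 (ω y : Fin n → ℝ) : ℝ := ⨆ i, ((ω i) ^ 2)⁻¹ * |y i|

/-- `y'' = max_i ω_i⁻¹ |y_i|`. -/
def y2 (ω y : Fin n → ℝ) : ℝ := ⨆ i, (ω i)⁻¹ * |y i|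

/-- The constant `3ν²(n y''² + 2 c_{Q,n}² y'² ‖Q̃‖₂²) / (n η⁴)`. -/
def rateConst (G : WeightedDigraph n) (α Δ η : ℝ) (ω y : Fin n → ℝ) : ℝ :=
  3 * nu G α Δ ω ^ 2 *
    (n * y2 ω y ^ 2
      + 2 * cPowN (matQ G α ω) ^ 2 * y1 ω y ^ 2 * norm2 (matQt G α ω) ^ 2)
    / (n * η ^ 4)

end QuantEst

end

/-! With `P = I - αL`, both stages have the form `e (t + 1) = P e (t) + perturbation`. Strong
connectivity and the positive diagonal make some power of the stochastic matrix `P` entrywise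
positive. Hence `ω > 0`, and that power contracts the sup norm on the vectors orthogonal to `ω`
(`pos_and_powContracts`). On this subspace `I - P` is bounded below, so a sum of deviations from
consensus is controlled by a bounded term plus the sum of the perturbations
(`PowContracts.norm_sum_le`). Cancellation among the perturbations therefore survives. The quantizer
is unbiased and every draw is independent of the past, so quantization errors at different times are
orthogonal and a sum of `K` of them has second moment at most `KΔ²`. In the first stage this gives
`z̄ᵢᵢ(t) - n^κ ωᵢ` a second moment of order `1/t`. In the second stage the corrections telescope:
the `ω`-average of `x(t)` is exactly `∑ ωᵢ n^{κ-1} yᵢ / z̄ᵢᵢ(t)`, whose distance to the sample mean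
again has second moment of order `1/t`, while the deviations from this average sum to a variable of
second moment `O(K)`. Together the mean square error of the running average is `O(1/K)`
(`exists_integral_xbar_sub_sq_le`). This is `o(log K / K)`, so the whole error fits into the
remainder, and of the leading constant only its nonnegativity matters. -/

noncomputable section

namespace QuantEst

/-! ### Perturbed linear recursions with an eventually contracting map. -/

section Contraction

variable {E : Type*} [NormedAddCommGroup E] [NormedSpace ℝ E]

/-- A nonexpansive map with a power that contracts the subspace `W` by the factor `c`. -/
structure PowContracts (T : E →ₗ[ℝ] E) (W : Submodule ℝ E) (m : ℕ) (c : ℝ) : Prop where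
  pos : 0 < m
  lt_one : c < 1
  nonneg : 0 ≤ c
  nonexp : ∀ x, ‖T x‖ ≤ ‖x‖
  contr : ∀ x ∈ W, ‖(T ^ m) x‖ ≤ c * ‖x‖

variable {T : E →ₗ[ℝ] E} {W : Submodule ℝ E} {m : ℕ} {c : ℝ}

lemma PowContracts.norm_sub_pow_le (h : PowContracts T W m c) {e : ℕ → E} {B : ℝ}
    (hB : ∀ t, ‖e (t + 1) - T (e t)‖ ≤ B) (t k : ℕ) :
    ‖e (t + k) - (T ^ k) (e t)‖ ≤ k * B := by
  induction k with
  | zero => simp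
  | succ k ih =>
    have h1 : e (t + (k + 1)) - (T ^ (k + 1)) (e t)
        = (e (t + k + 1) - T (e (t + k))) + T (e (t + k) - (T ^ k) (e t)) := by
      rw [pow_succ', Module.End.mul_apply, map_sub, ← add_assoc]; abel
    rw [h1]
    refine (norm_add_le _ _).trans ?_
    have := h.nonexp (e (t + k) - (T ^ k) (e t))
    have := hB (t + k)
    push_cast
    linarith

/-- A block of `m` steps gives `‖e (t + m)‖ ≤ c ‖e t‖ + m B`, and the claimed bound is stable under
this map. The first `m` steps need only nonexpansiveness. -/
lemma PowContracts.norm_le (h : PowContracts T W m c) {e : ℕ → E} {B : ℝ}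
    (heW : ∀ t, e t ∈ W) (hB : ∀ t, ‖e (t + 1) - T (e t)‖ ≤ B) (t : ℕ) :
    ‖e t‖ ≤ ‖e 0‖ + m * B / (1 - c) := by
  have hc : 0 < 1 - c := by linarith [h.lt_one]
  have hB0 : 0 ≤ B := (norm_nonneg _).trans (hB 0)
  have hmB : (m : ℝ) * B ≤ m * B / (1 - c) := by
    rw [le_div_iff₀ hc]
    have : 0 ≤ (m : ℝ) * B := by positivity
    nlinarith [h.nonneg]
  have hmul : m * B / (1 - c) * (1 - c) = m * B := by field_simp
  induction t using Nat.strong_induction_on with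
  | _ t ih =>
  by_cases htm : t < m
  · have h1 := h.norm_sub_pow_le hB 0 t
    have h2 : ∀ k, ‖(T ^ k) (e 0)‖ ≤ ‖e 0‖ := fun k => by
      induction k with
      | zero => simp
      | succ k ih => rw [pow_succ', Module.End.mul_apply]; exact (h.nonexp _).trans ih
    rw [zero_add] at h1
    have h3 := norm_sub_norm_le (e t) ((T ^ t) (e 0))
    have h4 : (t : ℝ) * B ≤ m * B := by gcongr
    linarith [h2 t]
  · obtain ⟨s, rfl⟩ := Nat.exists_eq_add_of_le' (not_lt.1 htm)
    have h1 := h.norm_sub_pow_le hB s m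
    have h2 := h.contr _ (heW s)
    have h3 := norm_sub_norm_le (e (s + m)) ((T ^ m) (e s))
    have h4 := mul_le_mul_of_nonneg_left (ih s (by have := h.pos; omega)) h.nonneg
    have := mul_nonneg hc.le (norm_nonneg (e 0))
    nlinarith

/-- The constant sequence `s` is a perturbed orbit with error `s - T s`. After `m` steps it has
drifted from `T ^ m s` by at most `m ‖s - T s‖`, yet `T ^ m` shrinks `s` by the factor `c`. -/
lemma PowContracts.norm_le_sub (h : PowContracts T W m c) {s : E} (hs : s ∈ W) :
    ‖s‖ ≤ m / (1 - c) * ‖s - T s‖ := by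
  have hc : 0 < 1 - c := by linarith [h.lt_one]
  have h1 := h.norm_sub_pow_le (e := fun _ => s) (fun _ => le_rfl) 0 m
  have h2 := h.contr s hs
  have h3 := norm_sub_norm_le s ((T ^ m) s)
  rw [div_mul_eq_mul_div, le_div_iff₀ hc]
  linarith

lemma PowContracts.norm_sum_le (h : PowContracts T W m c) {e : ℕ → E} {B : ℝ}
    (heW : ∀ t, e t ∈ W) (hB : ∀ t, ‖e (t + 1) - T (e t)‖ ≤ B) (K : ℕ) :
    ‖∑ k ∈ Finset.Icc 1 K, e k‖ ≤ m / (1 - c) * (2 * (‖e 0‖ + m * B / (1 - c))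
      + ‖∑ k ∈ Finset.Icc 1 K, (e (k + 1) - T (e k))‖) := by
  have hc : 0 < 1 - c := by linarith [h.lt_one]
  refine (h.norm_le_sub (W.sum_mem fun k _ => heW k)).trans ?_
  -- Summation by parts leaves two boundary terms and the sum of the perturbations inside a single
  -- norm.
  have h1 : ∑ k ∈ Finset.Icc 1 K, e k - T (∑ k ∈ Finset.Icc 1 K, e k)
      = (e 1 - e (K + 1)) + ∑ k ∈ Finset.Icc 1 K, (e (k + 1) - T (e k)) := by
    have : ∑ k ∈ Finset.Icc 1 K, (e (k + 1) - e k) = e (K + 1) - e 1 := by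
      rw [← Finset.Ico_succ_right_eq_Icc]
      exact Finset.sum_Ico_sub e (by simp)
    simp only [Finset.sum_sub_distrib] at this ⊢
    rw [map_sum, ← neg_sub (e (K + 1)), ← this]; abel
  rw [h1]
  gcongr
  refine (norm_add_le _ _).trans ?_
  gcongr
  refine (norm_sub_le _ _).trans ?_
  linarith [h.norm_le heW hB 1, h.norm_le heW hB (K + 1)]

end Contraction

/-! ### Stochastic matrices, primitivity and contraction orthogonally to `ω`. -/

section Stochastic

variable {n : ℕ}

/-- A nonnegative matrix with row sums `1`. -/
structure RowStoch (P : Matrix (Fin n) (Fin n) ℝ) : Prop where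
  nonneg : ∀ i j, 0 ≤ P i j
  row : ∀ i, ∑ j, P i j = 1

lemma RowStoch.mul {P R : Matrix (Fin n) (Fin n) ℝ} (hP : RowStoch P) (hR : RowStoch R) :
    RowStoch (P * R) where
  nonneg i j := by
    rw [Matrix.mul_apply]
    exact Finset.sum_nonneg fun k _ => mul_nonneg (hP.nonneg _ _) (hR.nonneg _ _)
  row i := by
    simp_rw [Matrix.mul_apply]
    rw [Finset.sum_comm]
    simp_rw [← Finset.mul_sum, hR.row, mul_one, hP.row]

lemma RowStoch.pow {P : Matrix (Fin n) (Fin n) ℝ} (hP : RowStoch P) (k : ℕ) :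
    RowStoch (P ^ k) := by
  induction k with
  | zero =>
    refine ⟨fun i j => ?_, fun i => ?_⟩
    · rw [pow_zero, Matrix.one_apply]; split_ifs <;> norm_num
    · simp [Matrix.one_apply]
  | succ k ih => rw [pow_succ]; exact ih.mul hP

lemma RowStoch.norm_mulVec_le {P : Matrix (Fin n) (Fin n) ℝ} (hP : RowStoch P)
    (x : Fin n → ℝ) : ‖P.mulVec x‖ ≤ ‖x‖ := by
  refine (pi_norm_le_iff_of_nonneg (norm_nonneg _)).2 fun i => ?_
  calc ‖P.mulVec x i‖ = ‖∑ j, P i j * x j‖ := rfl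
    _ ≤ ∑ j, ‖P i j * x j‖ := norm_sum_le _ _
    _ ≤ ∑ j, P i j * ‖x‖ := Finset.sum_le_sum fun j _ => by
        rw [norm_mul, Real.norm_of_nonneg (hP.nonneg i j)]
        exact mul_le_mul_of_nonneg_left (norm_le_pi_norm x j) (hP.nonneg i j)
    _ = ‖x‖ := by rw [← Finset.sum_mul, hP.row, one_mul]

/-- The stationary vector of a positive stochastic matrix is at least the smallest entry. -/
lemma RowStoch.le_stationary {M : Matrix (Fin n) (Fin n) ℝ} (hM : RowStoch M) {β : ℝ}
    (hβ : 0 < β) (hMβ : ∀ i j, β ≤ M i j) {ω : Fin n → ℝ} (hω : Matrix.vecMul ω M = ω)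
    (hω1 : ∑ i, ω i = 1) (j : Fin n) : β ≤ ω j := by
  have hexp : ∀ j, ω j = ∑ i, ω i * (M i j - β) + β := fun j => by
    have : ω j = ∑ i, ω i * M i j := (congrFun hω j).symm
    simp_rw [mul_sub, Finset.sum_sub_distrib, ← Finset.sum_mul, hω1]
    linarith
  -- No sign of `ω` is assumed. Summing this over `j` shows that the total negative part `N`
  -- satisfies `N ≤ (1 - nβ) N`, so it vanishes.
  have hle : ∀ j, max (-ω j) 0 ≤ ∑ i, max (-ω i) 0 * (M i j - β) := fun j => by
    refine max_le ?_ (Finset.sum_nonneg fun i _ =>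
      mul_nonneg (le_max_right _ _) (by linarith [hMβ i j]))
    rw [hexp j]
    have : -∑ i, ω i * (M i j - β) ≤ ∑ i, max (-ω i) 0 * (M i j - β) := by
      rw [← Finset.sum_neg_distrib]
      refine Finset.sum_le_sum fun i _ => ?_
      rw [← neg_mul]
      exact mul_le_mul_of_nonneg_right (le_max_left _ _) (by linarith [hMβ i j])
    linarith
  have hsum := Finset.sum_le_sum fun j (_ : j ∈ Finset.univ) => hle j
  rw [Finset.sum_comm] at hsum
  simp_rw [← Finset.mul_sum, Finset.sum_sub_distrib, hM.row, ← Finset.sum_mul] at hsum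
  have hN : 0 ≤ ∑ i, max (-ω i) 0 := Finset.sum_nonneg fun i _ => le_max_right _ _
  have hn : (0 : ℝ) < ∑ _j : Fin n, β := Finset.sum_pos (fun _ _ => hβ) ⟨j, Finset.mem_univ j⟩
  have hN0 : ∑ i, max (-ω i) 0 = 0 := by nlinarith
  have hpos : ∀ i, 0 ≤ ω i := fun i => by
    have := (Finset.sum_eq_zero_iff_of_nonneg (fun i _ => le_max_right (-ω i) 0)).1 hN0 i
      (Finset.mem_univ i)
    have := le_max_left (-ω i) 0
    linarith
  rw [hexp j]
  have : 0 ≤ ∑ i, ω i * (M i j - β) :=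
    Finset.sum_nonneg fun i _ => mul_nonneg (hpos i) (by linarith [hMβ i j])
  linarith

/-- Doeblin's argument: subtracting `β ω` from every row does not change `M x`, keeps the entries
nonnegative, and leaves row sums `1 - β`. -/
lemma RowStoch.norm_mulVec_le_of_orthogonal {M : Matrix (Fin n) (Fin n) ℝ} (hM : RowStoch M)
    {β : ℝ} (hβ : 0 ≤ β) (hMβ : ∀ i j, β ≤ M i j) {ω : Fin n → ℝ} (hω0 : ∀ i, 0 ≤ ω i)
    (hω1 : ∑ i, ω i = 1) {x : Fin n → ℝ} (hx : ∑ i, ω i * x i = 0) :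
    ‖M.mulVec x‖ ≤ (1 - β) * ‖x‖ := by
  have hω_le : ∀ i, ω i ≤ 1 := fun i => by
    rw [← hω1]; exact Finset.single_le_sum (fun i _ => hω0 i) (Finset.mem_univ i)
  have hnn : ∀ i j, 0 ≤ M i j - β * ω j := fun i j => by
    nlinarith [hMβ i j, hω_le j, hω0 j]
  have hrow : ∀ i, ∑ j, (M i j - β * ω j) = 1 - β := fun i => by
    rw [Finset.sum_sub_distrib, hM.row, ← Finset.mul_sum, hω1, mul_one]
  rcases isEmpty_or_nonempty (Fin n) with hE | ⟨⟨i₀⟩⟩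
  · simp at hω1
  have hβ1 : 0 ≤ 1 - β := by rw [← hrow i₀]; exact Finset.sum_nonneg fun j _ => hnn i₀ j
  refine (pi_norm_le_iff_of_nonneg (by positivity)).2 fun i => ?_
  calc ‖M.mulVec x i‖ = ‖∑ j, (M i j - β * ω j) * x j‖ := by
        congr 1
        simp_rw [sub_mul, Finset.sum_sub_distrib, mul_assoc, ← Finset.mul_sum, hx]
        simp [Matrix.mulVec, dotProduct]
    _ ≤ ∑ j, ‖(M i j - β * ω j) * x j‖ := norm_sum_le _ _
    _ ≤ ∑ j, (M i j - β * ω j) * ‖x‖ := Finset.sum_le_sum fun j _ => by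
        rw [norm_mul, Real.norm_of_nonneg (hnn i j)]
        exact mul_le_mul_of_nonneg_left (norm_le_pi_norm x j) (hnn i j)
    _ = (1 - β) * ‖x‖ := by rw [← Finset.sum_mul, hrow]

lemma RowStoch.pos_pow_mono {P : Matrix (Fin n) (Fin n) ℝ} (hP : RowStoch P)
    (hd : ∀ i, 0 < P i i) {i j : Fin n} {k l : ℕ} (hkl : k ≤ l) (h : 0 < (P ^ k) i j) :
    0 < (P ^ l) i j := by
  induction l, hkl using Nat.le_induction with
  | base => exact h
  | succ l _ ih =>
    rw [pow_succ, Matrix.mul_apply]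
    exact Finset.sum_pos' (fun q _ => mul_nonneg ((hP.pow l).nonneg _ _) (hP.nonneg _ _))
      ⟨j, Finset.mem_univ j, mul_pos ih (hd j)⟩

variable (G : WeightedDigraph n) (α : ℝ)

/-- The averaging matrix `I - αL`. -/
def WeightedDigraph.avg : Matrix (Fin n) (Fin n) ℝ := 1 - α • G.lap

variable {G α}

lemma WeightedDigraph.lap_row (i : Fin n) : ∑ j, G.lap i j = 0 := by
  simp [WeightedDigraph.lap, Matrix.diagonal_apply, WeightedDigraph.deg]

lemma WeightedDigraph.lap_mulVec (x : Fin n → ℝ) (i : Fin n) :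
    G.lap.mulVec x i = -∑ l, G.a i l * (x l - x i) := by
  rw [WeightedDigraph.lap, Matrix.sub_mulVec, Pi.sub_apply, Matrix.mulVec_diagonal]
  simp only [WeightedDigraph.deg, Matrix.mulVec, dotProduct, mul_sub, Finset.sum_sub_distrib,
    Finset.sum_mul]
  ring

lemma WeightedDigraph.avg_diag (i : Fin n) : G.avg α i i = 1 - α * G.deg i := by
  simp [WeightedDigraph.avg, WeightedDigraph.lap, G.no_loop]

lemma WeightedDigraph.avg_off {i j : Fin n} (h : i ≠ j) : G.avg α i j = α * G.a i j := by
  simp [WeightedDigraph.avg, WeightedDigraph.lap, h]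

lemma WeightedDigraph.rowStoch_avg (hα : 0 < α) (hαd : ∀ i, α * G.deg i < 1) :
    RowStoch (G.avg α) where
  nonneg i j := by
    rcases eq_or_ne i j with rfl | h
    · rw [avg_diag]; linarith [hαd i]
    · rw [avg_off h]; exact mul_nonneg hα.le (G.nonneg i j)
  row i := by
    simp [WeightedDigraph.avg, Matrix.one_apply, ← Finset.mul_sum, lap_row]

lemma WeightedDigraph.exists_pos_pow_avg (hG : G.StronglyConnected) (hα : 0 < α)
    (hαd : ∀ i, α * G.deg i < 1) : ∃ m, 0 < m ∧ ∀ i j, 0 < (G.avg α ^ m) i j := by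
  have hP := G.rowStoch_avg hα hαd
  have hd : ∀ i, 0 < G.avg α i i := fun i => by rw [avg_diag]; linarith [hαd i]
  have h1 : ∀ i j, ∃ k, 0 < (G.avg α ^ k) i j := fun i j => by
    induction hG j i with
    | refl => exact ⟨0, by simp⟩
    | @tail b c _ hbc ih =>
      obtain ⟨k, hk⟩ := ih
      refine ⟨k + 1, ?_⟩
      rw [pow_succ', Matrix.mul_apply]
      refine Finset.sum_pos' (fun q _ => mul_nonneg (hP.nonneg _ _) ((hP.pow k).nonneg _ _))
        ⟨b, Finset.mem_univ b, mul_pos ?_ hk⟩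
      rcases eq_or_ne c b with rfl | h
      · exact hd _
      · rw [avg_off h]; exact mul_pos hα hbc
  choose k hk using h1
  -- The positive diagonal preserves positivity under larger exponents, so any common upper bound
  -- works for all pairs; the `1` keeps it positive.
  refine ⟨(∑ i, ∑ j, k i j) + 1, Nat.succ_pos _, fun i j => hP.pos_pow_mono hd ?_ (hk i j)⟩
  calc k i j ≤ ∑ j, k i j :=
        Finset.single_le_sum (f := k i) (fun _ _ => Nat.zero_le _) (Finset.mem_univ j)
    _ ≤ ∑ i, ∑ j, k i j := Finset.single_le_sum (f := fun i => ∑ j, k i j)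
        (fun _ _ => Nat.zero_le _) (Finset.mem_univ i)
    _ ≤ _ := Nat.le_succ _

/-- The vectors orthogonal to `ω`. -/
def perp (ω : Fin n → ℝ) : Submodule ℝ (Fin n → ℝ) where
  carrier := {x | ∑ i, ω i * x i = 0}
  add_mem' {x y} hx hy := by
    simp only [Set.mem_ofPred_eq, Pi.add_apply, mul_add, Finset.sum_add_distrib] at *
    rw [hx, hy, add_zero]
  zero_mem' := by simp
  smul_mem' r x hx := by
    simp only [Set.mem_ofPred_eq, Pi.smul_apply, smul_eq_mul, mul_left_comm _ r] at *
    rw [← Finset.mul_sum, hx, mul_zero]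

lemma mem_perp {ω x : Fin n → ℝ} : x ∈ perp ω ↔ ∑ i, ω i * x i = 0 := Iff.rfl

lemma WeightedDigraph.pos_and_powContracts (hG : G.StronglyConnected) {ω : Fin n → ℝ}
    (hωL : Matrix.vecMul ω G.lap = 0) (hω1 : ∑ i, ω i = 1) (hα : 0 < α)
    (hαd : ∀ i, α * G.deg i < 1) :
    (∀ i, 0 < ω i) ∧ ∃ m c, PowContracts (Matrix.mulVecLin (G.avg α)) (perp ω) m c := by
  have hP := G.rowStoch_avg hα hαd
  obtain ⟨m, hm, hpos⟩ := exists_pos_pow_avg hG hα hαd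
  have hne : Nonempty (Fin n) := by
    by_contra h
    rw [not_nonempty_iff] at h
    simp at hω1
  obtain ⟨p, hp⟩ := Finite.exists_min fun p : Fin n × Fin n => (G.avg α ^ m) p.1 p.2
  set β := (G.avg α ^ m) p.1 p.2
  have hβ : 0 < β := hpos _ _
  have hMβ : ∀ i j, β ≤ (G.avg α ^ m) i j := fun i j => hp (i, j)
  have hωP : Matrix.vecMul ω (G.avg α) = ω := by
    simp [WeightedDigraph.avg, Matrix.vecMul_sub, Matrix.vecMul_smul, hωL]
  have hωM : ∀ k, Matrix.vecMul ω (G.avg α ^ k) = ω := fun k => by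
    induction k with
    | zero => simp
    | succ k ih => rw [pow_succ, ← Matrix.vecMul_vecMul, ih, hωP]
  have hω : ∀ i, 0 < ω i := fun i => hβ.trans_le ((hP.pow m).le_stationary hβ hMβ (hωM m) hω1 i)
  have hβ1 : β ≤ 1 := by
    rw [← (hP.pow m).row p.1]
    exact Finset.single_le_sum (fun j _ => (hpos _ j).le) (Finset.mem_univ p.2)
  refine ⟨hω, m, 1 - β, hm, by linarith, by linarith, fun x => hP.norm_mulVec_le x,
    fun x hx => ?_⟩
  have : ∀ k, (Matrix.mulVecLin (G.avg α) ^ k) = Matrix.mulVecLin (G.avg α ^ k) := fun k => by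
    induction k with
    | zero => simp [Module.End.one_eq_id]
    | succ k ih => rw [pow_succ, ih, pow_succ, Matrix.mulVecLin_mul]; rfl
  rw [this]
  exact (hP.pow m).norm_mulVec_le_of_orthogonal hβ.le hMβ (fun i => (hω i).le) hω1 hx

end Stochastic

/-! ### Bounds for the two stages, realization by realization. -/

section Dynamics

variable {n : ℕ}

lemma abs_quant_sub_le {Δ : ℝ} (hΔ : 0 < Δ) (r x : ℝ) : |quant Δ r x - x| ≤ Δ := by
  have hx : x = x / Δ * Δ := by field_simp
  have h1 := Int.floor_le (x / Δ)
  have h2 := Int.lt_floor_add_one (x / Δ)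
  have h3 := Int.le_ceil (x / Δ)
  have h4 := Int.ceil_lt_add_one (x / Δ)
  unfold quant
  generalize x / Δ = q at *
  subst hx
  split_ifs
  · rw [← sub_mul, abs_mul, abs_of_pos hΔ]
    have : |(⌈q⌉ : ℝ) - q| ≤ 1 := abs_le.2 ⟨by linarith, by linarith⟩
    nlinarith
  · rw [← sub_mul, abs_mul, abs_of_pos hΔ]
    have : |(⌊q⌋ : ℝ) - q| ≤ 1 := abs_le.2 ⟨by linarith, by linarith⟩
    nlinarith

lemma exists_norm_mulVec_le (M : Matrix (Fin n) (Fin n) ℝ) :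
    ∃ C : ℝ, 0 ≤ C ∧ ∀ x, ‖M.mulVec x‖ ≤ C * ‖x‖ :=
  ⟨‖LinearMap.toContinuousLinearMap M.mulVecLin‖, norm_nonneg _,
    (LinearMap.toContinuousLinearMap M.mulVecLin).le_opNorm⟩

lemma mulVec_perp {ω : Fin n → ℝ} {M : Matrix (Fin n) (Fin n) ℝ} (hM : Matrix.vecMul ω M = 0)
    (x : Fin n → ℝ) : ∑ i, ω i * M.mulVec x i = 0 := by
  have : ω ⬝ᵥ M.mulVec x = 0 := by rw [Matrix.dotProduct_mulVec, hM, zero_dotProduct]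
  exact this

lemma WeightedDigraph.avg_mulVec (G : WeightedDigraph n) (α : ℝ) (x : Fin n → ℝ) :
    (G.avg α).mulVec x = x - α • G.lap.mulVec x := by
  rw [WeightedDigraph.avg, Matrix.sub_mulVec, Matrix.one_mulVec, Matrix.smul_mulVec]

/-- One quantized averaging step in terms of the quantization errors. -/
lemma WeightedDigraph.quantized_step (G : WeightedDigraph n) (α : ℝ) (x q : Fin n → ℝ) :
    (fun i => x i + α * ∑ l, G.a i l * (q l - q i))
      = (G.avg α).mulVec x - α • G.lap.mulVec (q - x) := by
  ext i
  rw [G.avg_mulVec, Matrix.mulVec_sub]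
  simp only [Pi.sub_apply, Pi.smul_apply, smul_eq_mul, G.lap_mulVec]
  ring

lemma WeightedDigraph.avg_mulVec_sub_const {G : WeightedDigraph n} (α : ℝ) (x : Fin n → ℝ)
    (r : ℝ) : (G.avg α).mulVec (fun i => x i - r) = fun i => (G.avg α).mulVec x i - r := by
  ext i
  simp only [G.avg_mulVec, Pi.sub_apply, Pi.smul_apply, G.lap_mulVec, sub_sub_sub_cancel_right]
  ring

/-- The quantization errors of the first stage. -/
def noise1 (G : WeightedDigraph n) (α Δ κ : ℝ) (u : ℕ → Fin n → Fin n → ℝ) (t : ℕ) (j : Fin n) :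
    Fin n → ℝ := fun i =>
  quant Δ (u t i j) (stage1 G α Δ κ u t i j) - stage1 G α Δ κ u t i j

/-- The deviation of the `j`-th components of the first stage from consensus. -/
def dev1 (G : WeightedDigraph n) (α Δ κ : ℝ) (ω : Fin n → ℝ) (u : ℕ → Fin n → Fin n → ℝ)
    (t : ℕ) (j : Fin n) : Fin n → ℝ := fun i => stage1 G α Δ κ u t i j - (n : ℝ) ^ κ * ω j

/-- The corrected state of the second stage. -/
def xhat (G : WeightedDigraph n) (α Δ κ : ℝ) (k₀ t₀ : ℕ) (y : Fin n → ℝ)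
    (u : ℕ → Fin n → Fin n → ℝ) (v : ℕ → Fin n → ℝ) (s : ℕ) : Fin n → ℝ := fun l =>
  stage2 G α Δ κ k₀ t₀ y u v s l + corr G α Δ κ k₀ t₀ y u (t₀ + s) l

/-- The quantization errors of the second stage. -/
def noise2 (G : WeightedDigraph n) (α Δ κ : ℝ) (k₀ t₀ : ℕ) (y : Fin n → ℝ)
    (u : ℕ → Fin n → Fin n → ℝ) (v : ℕ → Fin n → ℝ) (s : ℕ) : Fin n → ℝ := fun i =>
  quant Δ (v (t₀ + s) i) (xhat G α Δ κ k₀ t₀ y u v s i) - xhat G α Δ κ k₀ t₀ y u v s i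

lemma norm_noise1_le (G : WeightedDigraph n) (α κ : ℝ) {Δ : ℝ} (hΔ : 0 < Δ)
    (u : ℕ → Fin n → Fin n → ℝ) (t : ℕ) (j : Fin n) : ‖noise1 G α Δ κ u t j‖ ≤ Δ :=
  (pi_norm_le_iff_of_nonneg hΔ.le).2 fun _ => abs_quant_sub_le hΔ _ _

lemma norm_noise2_le (G : WeightedDigraph n) (α κ : ℝ) {Δ : ℝ} (hΔ : 0 < Δ) (k₀ t₀ : ℕ)
    (y : Fin n → ℝ) (u : ℕ → Fin n → Fin n → ℝ) (v : ℕ → Fin n → ℝ) (s : ℕ) :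
    ‖noise2 G α Δ κ k₀ t₀ y u v s‖ ≤ Δ :=
  (pi_norm_le_iff_of_nonneg hΔ.le).2 fun _ => abs_quant_sub_le hΔ _ _

lemma dev1_succ_sub (G : WeightedDigraph n) (α Δ κ : ℝ) (ω : Fin n → ℝ)
    (u : ℕ → Fin n → Fin n → ℝ) (t : ℕ) (j : Fin n) :
    dev1 G α Δ κ ω u (t + 1) j - (G.avg α).mulVec (dev1 G α Δ κ ω u t j)
      = -(α • G.lap.mulVec (noise1 G α Δ κ u t j)) := by
  have h := G.quantized_step α (fun i => stage1 G α Δ κ u t i j)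
    (fun i => quant Δ (u t i j) (stage1 G α Δ κ u t i j))
  unfold dev1
  rw [WeightedDigraph.avg_mulVec_sub_const]
  ext i
  have hi := congrFun h i
  simp only [Pi.sub_apply, Pi.neg_apply, stage1] at hi ⊢
  rw [hi]
  change _ - (α • G.lap.mulVec (noise1 G α Δ κ u t j)) i - _ - _ = _
  ring

variable {G : WeightedDigraph n} {ω : Fin n → ℝ}

/-- The target `n^κ ω j` is the `ω`-average of the initial column, and `ωᵀL = 0` makes that average
invariant even under quantization. -/
lemma dev1_mem_perp (hωL : Matrix.vecMul ω G.lap = 0) (hω1 : ∑ i, ω i = 1) (α Δ κ : ℝ)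
    (u : ℕ → Fin n → Fin n → ℝ) (t : ℕ) (j : Fin n) : dev1 G α Δ κ ω u t j ∈ perp ω := by
  induction t with
  | zero =>
    rw [mem_perp]
    simp only [dev1, stage1, mul_sub, mul_ite, mul_zero, Finset.sum_sub_distrib,
      ← Finset.sum_mul, hω1]
    simp
    ring
  | succ t ih =>
    have h := dev1_succ_sub G α Δ κ ω u t j
    rw [sub_eq_iff_eq_add] at h
    rw [h, G.avg_mulVec]
    have hp : ∀ x, G.lap.mulVec x ∈ perp ω := mulVec_perp hωL
    exact add_mem (neg_mem ((perp ω).smul_mem _ (hp _)))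
      (sub_mem ih ((perp ω).smul_mem _ (hp _)))

/-- The accumulated deviation in the first stage is controlled by the accumulated noise. -/
lemma exists_sum_dev1_le {α Δ : ℝ} {m : ℕ} {c : ℝ}
    (hP : PowContracts (Matrix.mulVecLin (G.avg α)) (perp ω) m c)
    (hωL : Matrix.vecMul ω G.lap = 0) (hω1 : ∑ i, ω i = 1) (hΔ : 0 < Δ) (κ : ℝ)
    (k₀ : ℕ) : ∃ C : ℝ, 0 ≤ C ∧ ∀ u K j,
      ‖∑ k ∈ Finset.Icc 1 K, dev1 G α Δ κ ω u (k₀ + k) j‖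
        ≤ C * (1 + ‖∑ k ∈ Finset.Icc 1 K, noise1 G α Δ κ u (k₀ + k) j‖) := by
  obtain ⟨CL, hCL0, hCL⟩ := exists_norm_mulVec_le (α • G.lap)
  have hc : 0 < 1 - c := by linarith [hP.lt_one]
  have hB : ∀ u j t, ‖dev1 G α Δ κ ω u (t + 1) j
      - Matrix.mulVecLin (G.avg α) (dev1 G α Δ κ ω u t j)‖ ≤ CL * Δ := fun u j t => by
    rw [Matrix.mulVecLin_apply, dev1_succ_sub, norm_neg, ← Matrix.smul_mulVec]
    exact (hCL _).trans (by gcongr; exact norm_noise1_le G α κ hΔ u t j)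
  set E₀ : ℝ := ∑ j, ‖(fun i => (if i = j then (n : ℝ) ^ κ else 0) - (n : ℝ) ^ κ * ω j : Fin n → ℝ)‖
  have hE₀ : 0 ≤ E₀ := Finset.sum_nonneg fun _ _ => norm_nonneg _
  have h0 : ∀ u j, ‖dev1 G α Δ κ ω u 0 j‖ ≤ E₀ := fun u j =>
    Finset.single_le_sum (f := fun j => ‖(fun i => (if i = j then (n : ℝ) ^ κ else 0)
      - (n : ℝ) ^ κ * ω j : Fin n → ℝ)‖) (fun _ _ => norm_nonneg _) (Finset.mem_univ j)
  set R₀ : ℝ := E₀ + m * (CL * Δ) / (1 - c) with hR₀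
  have hR₀0 : 0 ≤ R₀ := by positivity
  have hk : ∀ u j t, ‖dev1 G α Δ κ ω u t j‖ ≤ R₀ := fun u j t =>
    (hP.norm_le (e := fun t => dev1 G α Δ κ ω u t j)
      (fun t => dev1_mem_perp hωL hω1 α Δ κ u t j) (hB u j) t).trans
      (by simp only [hR₀]; gcongr; exact h0 u j)
  -- The sum starts at time `k₀`, where the deviation is only known to be at most `R₀`; hence the
  -- second copy of the perturbation term.
  set R : ℝ := R₀ + m * (CL * Δ) / (1 - c) with hR
  have hR0 : 0 ≤ R := by positivity
  refine ⟨m / (1 - c) * (2 * R + CL), by positivity, fun u K j => ?_⟩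
  have h := hP.norm_sum_le (e := fun t => dev1 G α Δ κ ω u (k₀ + t) j)
    (fun t => dev1_mem_perp hωL hω1 α Δ κ u _ j) (fun t => hB u j (k₀ + t)) K
  refine h.trans ?_
  rw [mul_assoc]
  gcongr
  have hs : ∑ k ∈ Finset.Icc 1 K, (dev1 G α Δ κ ω u (k₀ + (k + 1)) j
      - Matrix.mulVecLin (G.avg α) (dev1 G α Δ κ ω u (k₀ + k) j))
      = -((α • G.lap).mulVec (∑ k ∈ Finset.Icc 1 K, noise1 G α Δ κ u (k₀ + k) j)) := by
    rw [Matrix.mulVec_sum, ← Finset.sum_neg_distrib]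
    refine Finset.sum_congr rfl fun k _ => ?_
    rw [Matrix.mulVecLin_apply, ← add_assoc, dev1_succ_sub, Matrix.smul_mulVec]
  rw [hs, norm_neg]
  have h1 := hCL (∑ k ∈ Finset.Icc 1 K, noise1 G α Δ κ u (k₀ + k) j)
  have h2 : ‖dev1 G α Δ κ ω u (k₀ + 0) j‖ + m * (CL * Δ) / (1 - c) ≤ R := by
    simp only [hR]; gcongr; exact hk u j _
  have h3 := norm_nonneg (∑ k ∈ Finset.Icc 1 K, noise1 G α Δ κ u (k₀ + k) j)
  have := mul_nonneg hR0 h3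
  nlinarith

lemma zbar_sub_eq (G : WeightedDigraph n) (α Δ κ : ℝ) (k₀ : ℕ) (ω : Fin n → ℝ)
    (u : ℕ → Fin n → Fin n → ℝ) {K : ℕ} (hK : 0 < K) (i j : Fin n) :
    zbar G α Δ κ k₀ u K i j - (n : ℝ) ^ κ * ω j
      = (1 / (K : ℝ)) * (∑ k ∈ Finset.Icc 1 K, dev1 G α Δ κ ω u (k₀ + k) j) i := by
  have hK' : (K : ℝ) ≠ 0 := by positivity
  have : ∑ k ∈ Finset.Icc (k₀ + 1) (k₀ + K), stage1 G α Δ κ u k i j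
      = ∑ k ∈ Finset.Icc 1 K, stage1 G α Δ κ u (k₀ + k) i j := by
    refine Finset.sum_nbij' (fun k => k - k₀) (fun k => k₀ + k) ?_ ?_ ?_ ?_ ?_ <;>
      simp only [Finset.mem_Icc] <;> intro k hk
    any_goals omega
    rw [Nat.add_sub_cancel' (by omega)]
  rw [zbar, this, Finset.sum_apply]
  simp only [dev1, Finset.sum_sub_distrib, Finset.sum_const, Nat.card_Icc, nsmul_eq_mul]
  field_simp
  simp
  ring

/-- The rescaled observation `n^{κ-1} y_i / z̄_{ii}(t)`. -/
def rescaled (G : WeightedDigraph n) (α Δ κ : ℝ) (k₀ : ℕ) (y : Fin n → ℝ)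
    (u : ℕ → Fin n → Fin n → ℝ) (t : ℕ) : Fin n → ℝ := fun i =>
  (n : ℝ) ^ (κ - 1) / zbar G α Δ κ k₀ u t i i * y i

/-- The corrections are increments of `rescaled`, the first one starting from `y` instead; this is
why their sums telescope. -/
lemma corr_start (G : WeightedDigraph n) (α Δ κ : ℝ) (k₀ t₀ : ℕ) (y : Fin n → ℝ)
    (u : ℕ → Fin n → Fin n → ℝ) :
    corr G α Δ κ k₀ t₀ y u t₀ = rescaled G α Δ κ k₀ y u (t₀ + 1) - y := by
  ext i; simp [corr, rescaled]; ring

lemma corr_add (G : WeightedDigraph n) (α Δ κ : ℝ) (k₀ t₀ : ℕ) (y : Fin n → ℝ)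
    (u : ℕ → Fin n → Fin n → ℝ) {s : ℕ} (hs : 0 < s) :
    corr G α Δ κ k₀ t₀ y u (t₀ + s)
      = rescaled G α Δ κ k₀ y u (t₀ + (s + 1)) - rescaled G α Δ κ k₀ y u (t₀ + s) := by
  ext i; simp [corr, rescaled, hs.ne', add_assoc]; ring

lemma stage2_succ (G : WeightedDigraph n) (α Δ κ : ℝ) (k₀ t₀ : ℕ) (y : Fin n → ℝ)
    (u : ℕ → Fin n → Fin n → ℝ) (v : ℕ → Fin n → ℝ) (s : ℕ) :
    stage2 G α Δ κ k₀ t₀ y u v (s + 1) = (G.avg α).mulVec (xhat G α Δ κ k₀ t₀ y u v s)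
      - α • G.lap.mulVec (noise2 G α Δ κ k₀ t₀ y u v s) :=
  G.quantized_step α (xhat G α Δ κ k₀ t₀ y u v s)
    (fun i => quant Δ (v (t₀ + s) i) (xhat G α Δ κ k₀ t₀ y u v s i))

lemma sum_mul_avg_mulVec (hωL : Matrix.vecMul ω G.lap = 0) (α : ℝ) (x : Fin n → ℝ) :
    ∑ i, ω i * (G.avg α).mulVec x i = ∑ i, ω i * x i := by
  simp only [G.avg_mulVec, Pi.sub_apply, Pi.smul_apply, smul_eq_mul, mul_sub,
    Finset.sum_sub_distrib, mul_left_comm _ α]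
  rw [← Finset.mul_sum, mulVec_perp hωL]
  simp

lemma weighted_stage2_succ (hωL : Matrix.vecMul ω G.lap = 0) (α Δ κ : ℝ) (k₀ t₀ : ℕ)
    (y : Fin n → ℝ) (u : ℕ → Fin n → Fin n → ℝ) (v : ℕ → Fin n → ℝ) (s : ℕ) :
    ∑ i, ω i * stage2 G α Δ κ k₀ t₀ y u v (s + 1) i
      = ∑ i, ω i * xhat G α Δ κ k₀ t₀ y u v s i := by
  simp only [stage2_succ, Pi.sub_apply, Pi.smul_apply, smul_eq_mul, mul_sub,
    Finset.sum_sub_distrib, mul_left_comm _ α]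
  rw [← Finset.mul_sum, mulVec_perp hωL, sum_mul_avg_mulVec hωL]
  simp

/-- The weighted average of the second stage is that of the rescaled observations. -/
lemma weighted_stage2 (hωL : Matrix.vecMul ω G.lap = 0) (α Δ κ : ℝ) (k₀ t₀ : ℕ)
    (y : Fin n → ℝ) (u : ℕ → Fin n → Fin n → ℝ) (v : ℕ → Fin n → ℝ) (s : ℕ) :
    ∑ i, ω i * stage2 G α Δ κ k₀ t₀ y u v (s + 1) i
      = ∑ i, ω i * rescaled G α Δ κ k₀ y u (t₀ + (s + 1)) i := by
  rw [weighted_stage2_succ hωL]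
  induction s with
  | zero => simp [xhat, corr_start, stage2]
  | succ s ih =>
    simp only [xhat, mul_add, Finset.sum_add_distrib]
    rw [weighted_stage2_succ hωL, ih, corr_add _ _ _ _ _ _ _ _ (Nat.succ_pos s)]
    simp [mul_sub]

/-- The deviation of the second stage from consensus. -/
def dev2 (G : WeightedDigraph n) (α Δ κ : ℝ) (k₀ t₀ : ℕ) (y ω : Fin n → ℝ)
    (u : ℕ → Fin n → Fin n → ℝ) (v : ℕ → Fin n → ℝ) (s : ℕ) : Fin n → ℝ := fun i =>
  stage2 G α Δ κ k₀ t₀ y u v s i - ∑ l, ω l * stage2 G α Δ κ k₀ t₀ y u v s l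

lemma dev2_mem_perp (hω1 : ∑ i, ω i = 1) (α Δ κ : ℝ) (k₀ t₀ : ℕ) (y : Fin n → ℝ)
    (u : ℕ → Fin n → Fin n → ℝ) (v : ℕ → Fin n → ℝ) (s : ℕ) :
    dev2 G α Δ κ k₀ t₀ y ω u v s ∈ perp ω := by
  rw [mem_perp]
  simp only [dev2, mul_sub, Finset.sum_sub_distrib, ← Finset.sum_mul, hω1, one_mul, sub_self]

/-- The average absorbs the `ω`-component of the correction, so the correction enters the deviation
through `Q = P - 1ωᵀ`. -/
lemma dev2_succ_sub (hωL : Matrix.vecMul ω G.lap = 0) (α Δ κ : ℝ) (k₀ t₀ : ℕ) (y : Fin n → ℝ)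
    (u : ℕ → Fin n → Fin n → ℝ) (v : ℕ → Fin n → ℝ) (s : ℕ) :
    dev2 G α Δ κ k₀ t₀ y ω u v (s + 1) - (G.avg α).mulVec (dev2 G α Δ κ k₀ t₀ y ω u v s)
      = (G.avg α - Matrix.vecMulVec (fun _ => 1) ω).mulVec (corr G α Δ κ k₀ t₀ y u (t₀ + s))
        - (α • G.lap).mulVec (noise2 G α Δ κ k₀ t₀ y u v s) := by
  unfold dev2
  rw [WeightedDigraph.avg_mulVec_sub_const, weighted_stage2_succ hωL, stage2_succ]
  have hx : xhat G α Δ κ k₀ t₀ y u v s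
      = stage2 G α Δ κ k₀ t₀ y u v s + corr G α Δ κ k₀ t₀ y u (t₀ + s) := rfl
  rw [hx, Matrix.mulVec_add, Matrix.sub_mulVec, Matrix.vecMulVec_mulVec]
  ext i
  simp [mul_add, Finset.sum_add_distrib, Matrix.smul_mulVec, dotProduct]
  ring

lemma norm_rescaled_le {α Δ κ η : ℝ} {k₀ : ℕ} {y : Fin n → ℝ} {u : ℕ → Fin n → Fin n → ℝ}
    {t : ℕ} (hω : ∀ i, 0 < ω i) (hη : 0 < η)
    (hw : ∀ i, η * ω i ≤ zbar G α Δ κ k₀ u t i i / (n : ℝ) ^ κ) :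
    ‖rescaled G α Δ κ k₀ y u t‖ ≤ ∑ i, |y i| / (n * η * ω i) := by
  refine (pi_norm_le_iff_of_nonneg (Finset.sum_nonneg fun i _ => ?_)).2 fun i => ?_
  · have := hω i; positivity
  refine le_trans ?_ (Finset.single_le_sum (f := fun i => |y i| / (n * η * ω i))
    (fun i _ => by have := hω i; positivity) (Finset.mem_univ i))
  have hn : (0 : ℝ) < n := Nat.cast_pos.2 i.pos
  have hnκ : (0 : ℝ) < (n : ℝ) ^ κ := Real.rpow_pos_of_pos hn _
  have hωi := hω i
  have h1 := (le_div_iff₀ hnκ).1 (hw i)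
  have h2 : 0 < η * ω i * (n : ℝ) ^ κ := by positivity
  have hz : 0 < zbar G α Δ κ k₀ u t i i := h2.trans_le h1
  rw [rescaled, norm_mul, norm_div, Real.norm_of_nonneg hz.le,
    Real.norm_of_nonneg (Real.rpow_nonneg hn.le _), Real.rpow_sub_one hn.ne', Real.norm_eq_abs]
  calc (n : ℝ) ^ κ / n / zbar G α Δ κ k₀ u t i i * |y i|
      ≤ (n : ℝ) ^ κ / n / (η * ω i * (n : ℝ) ^ κ) * |y i| := by gcongr
    _ = |y i| / (n * η * ω i) := by field_simp

/-- Each summand of the error equals `-yᵢ (z̄ᵢᵢ - n^κ ωᵢ) / (n z̄ᵢᵢ)`, and the lower bound on `z̄ᵢᵢ`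
controls the denominator. -/
lemma weighted_rescaled_sub_le {α Δ κ η : ℝ} {k₀ : ℕ} {y : Fin n → ℝ}
    {u : ℕ → Fin n → Fin n → ℝ} {t : ℕ} (hω : ∀ i, 0 < ω i) (hη : 0 < η)
    (hw : ∀ i, η * ω i ≤ zbar G α Δ κ k₀ u t i i / (n : ℝ) ^ κ) :
    |∑ i, ω i * rescaled G α Δ κ k₀ y u t i - sampleMean y|
      ≤ ∑ i, |y i| / (n * η * ω i * (n : ℝ) ^ κ)
          * |zbar G α Δ κ k₀ u t i i - (n : ℝ) ^ κ * ω i| := by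
  rw [sampleMean, Finset.mul_sum, ← Finset.sum_sub_distrib]
  refine (Finset.abs_sum_le_sum_abs _ _).trans (Finset.sum_le_sum fun i _ => ?_)
  have hn : (0 : ℝ) < n := Nat.cast_pos.2 i.pos
  have hnκ : (0 : ℝ) < (n : ℝ) ^ κ := Real.rpow_pos_of_pos hn _
  have hωi := hω i
  have h1 := (le_div_iff₀ hnκ).1 (hw i)
  have h2 : 0 < η * ω i * (n : ℝ) ^ κ := by positivity
  have hz : 0 < zbar G α Δ κ k₀ u t i i := h2.trans_le h1
  have h3 : ω i * rescaled G α Δ κ k₀ y u t i - 1 / n * y i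
      = -(y i / (n * zbar G α Δ κ k₀ u t i i)
        * (zbar G α Δ κ k₀ u t i i - (n : ℝ) ^ κ * ω i)) := by
    rw [rescaled, Real.rpow_sub_one hn.ne']
    field_simp
    ring
  rw [h3, abs_neg, abs_mul, abs_div, abs_of_pos (by positivity : 0 < n * zbar G α Δ κ k₀ u t i i)]
  have h4 : n * η * ω i * (n : ℝ) ^ κ ≤ n * zbar G α Δ κ k₀ u t i i := by
    calc n * η * ω i * (n : ℝ) ^ κ = n * (η * ω i * (n : ℝ) ^ κ) := by ring
      _ ≤ _ := by gcongr
  exact mul_le_mul_of_nonneg_right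
    (div_le_div_of_nonneg_left (abs_nonneg _) (by positivity) h4) (abs_nonneg _)

/-- Uniform bounds for the second stage over all realizations with well-defined corrections. -/
lemma exists_stage2_le {α Δ η : ℝ} {m : ℕ} {c : ℝ} (hω : ∀ i, 0 < ω i)
    (hP : PowContracts (Matrix.mulVecLin (G.avg α)) (perp ω) m c)
    (hωL : Matrix.vecMul ω G.lap = 0) (hω1 : ∑ i, ω i = 1) (hΔ : 0 < Δ) (κ : ℝ) (hη : 0 < η)
    (k₀ t₀ : ℕ) (y : Fin n → ℝ) : ∃ C : ℝ, 0 ≤ C ∧ ∀ u v,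
      (∀ t, t₀ + 1 ≤ t → ∀ i, η * ω i ≤ zbar G α Δ κ k₀ u t i i / (n : ℝ) ^ κ) →
      (∀ s, ‖stage2 G α Δ κ k₀ t₀ y u v (s + 1)‖ ≤ C) ∧
      (∀ K, ‖∑ s ∈ Finset.Icc 1 K, dev2 G α Δ κ k₀ t₀ y ω u v s‖
        ≤ C * (1 + ‖∑ s ∈ Finset.Icc 1 K, noise2 G α Δ κ k₀ t₀ y u v s‖)) := by
  obtain ⟨CL, hCL0, hCL⟩ := exists_norm_mulVec_le (α • G.lap)
  obtain ⟨CQ, hCQ0, hCQ⟩ := exists_norm_mulVec_le (G.avg α - Matrix.vecMulVec (fun _ => 1) ω)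
  have hc : 0 < 1 - c := by linarith [hP.lt_one]
  set Y : ℝ := ∑ i, |y i| / (n * η * ω i) with hYdef
  have hY0 : 0 ≤ Y := Finset.sum_nonneg fun i _ => by have := hω i; positivity
  set B : ℝ := CQ * (2 * Y + ‖y‖) + CL * Δ
  have hB0 : 0 ≤ B := by positivity
  set E₀ : ℝ := ‖(fun i => y i - ∑ l, ω l * y l : Fin n → ℝ)‖
  set R : ℝ := E₀ + m * B / (1 - c) with hR
  have hR0 : 0 ≤ R := by positivity
  have hA : 0 ≤ m / (1 - c) * (2 * R + CQ * (2 * Y) + CL) := by positivity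
  -- `R + Y` bounds the state (deviation plus average); the last term serves the summed deviations.
  refine ⟨R + Y + m / (1 - c) * (2 * R + CQ * (2 * Y) + CL), by positivity, fun u v hw => ?_⟩
  have hresc : ∀ s, ‖rescaled G α Δ κ k₀ y u (t₀ + (s + 1))‖ ≤ Y := fun s =>
    norm_rescaled_le hω hη (hw _ (by omega))
  have hcorr : ∀ s, ‖corr G α Δ κ k₀ t₀ y u (t₀ + s)‖ ≤ 2 * Y + ‖y‖ := fun s => by
    rcases Nat.eq_zero_or_pos s with rfl | hs
    · rw [add_zero, corr_start]
      refine (norm_sub_le _ _).trans ?_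
      linarith [hresc 0]
    · obtain ⟨r, rfl⟩ := Nat.exists_eq_succ_of_ne_zero hs.ne'
      rw [corr_add _ _ _ _ _ _ _ _ hs]
      refine (norm_sub_le _ _).trans ?_
      linarith [hresc r, hresc (r + 1), norm_nonneg y]
  have hmem : ∀ s, dev2 G α Δ κ k₀ t₀ y ω u v s ∈ perp ω := dev2_mem_perp hω1 α Δ κ k₀ t₀ y u v
  have hstep : ∀ s, ‖dev2 G α Δ κ k₀ t₀ y ω u v (s + 1)
      - Matrix.mulVecLin (G.avg α) (dev2 G α Δ κ k₀ t₀ y ω u v s)‖ ≤ B := fun s => by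
    rw [Matrix.mulVecLin_apply, dev2_succ_sub hωL]
    refine (norm_sub_le _ _).trans (add_le_add ((hCQ _).trans ?_) ((hCL _).trans ?_))
    · exact mul_le_mul_of_nonneg_left (hcorr s) hCQ0
    · exact mul_le_mul_of_nonneg_left (norm_noise2_le G α κ hΔ k₀ t₀ y u v s) hCL0
  constructor
  · intro s
    have h1 : ‖dev2 G α Δ κ k₀ t₀ y ω u v (s + 1)‖ ≤ R := hP.norm_le hmem hstep (s + 1)
    have h2 : ‖∑ l, ω l * stage2 G α Δ κ k₀ t₀ y u v (s + 1) l‖ ≤ Y := by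
      rw [weighted_stage2 hωL]
      calc _ ≤ ∑ l, ‖ω l * rescaled G α Δ κ k₀ y u (t₀ + (s + 1)) l‖ := norm_sum_le _ _
        _ ≤ ∑ l, ω l * Y := Finset.sum_le_sum fun l _ => by
            rw [norm_mul, Real.norm_of_nonneg (hω l).le]
            exact mul_le_mul_of_nonneg_left ((norm_le_pi_norm _ l).trans (hresc s)) (hω l).le
        _ = Y := by rw [← Finset.sum_mul, hω1, one_mul]
    refine (pi_norm_le_iff_of_nonneg (by positivity)).2 fun i => ?_
    have h3 : stage2 G α Δ κ k₀ t₀ y u v (s + 1) i = dev2 G α Δ κ k₀ t₀ y ω u v (s + 1) i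
        + ∑ l, ω l * stage2 G α Δ κ k₀ t₀ y u v (s + 1) l := by simp [dev2]
    rw [h3]
    refine (norm_add_le _ _).trans ?_
    linarith [(norm_le_pi_norm (dev2 G α Δ κ k₀ t₀ y ω u v (s + 1)) i).trans h1]
  · intro K
    have h := hP.norm_sum_le hmem hstep K
    have hsum : ∑ s ∈ Finset.Icc 1 K, (dev2 G α Δ κ k₀ t₀ y ω u v (s + 1)
        - Matrix.mulVecLin (G.avg α) (dev2 G α Δ κ k₀ t₀ y ω u v s))
        = (G.avg α - Matrix.vecMulVec (fun _ => 1) ω).mulVec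
            (rescaled G α Δ κ k₀ y u (t₀ + (K + 1)) - rescaled G α Δ κ k₀ y u (t₀ + 1))
          - (α • G.lap).mulVec (∑ s ∈ Finset.Icc 1 K, noise2 G α Δ κ k₀ t₀ y u v s) := by
      -- Only two bounded values of `rescaled` survive, so the corrections contribute a constant
      -- independent of `K`.
      have htel : ∑ s ∈ Finset.Icc 1 K, corr G α Δ κ k₀ t₀ y u (t₀ + s)
          = rescaled G α Δ κ k₀ y u (t₀ + (K + 1)) - rescaled G α Δ κ k₀ y u (t₀ + 1) := by
        rw [Finset.sum_congr rfl fun s hs => corr_add G α Δ κ k₀ t₀ y u (Finset.mem_Icc.1 hs).1,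
          ← Finset.Ico_succ_right_eq_Icc]
        exact Finset.sum_Ico_sub (fun s => rescaled G α Δ κ k₀ y u (t₀ + s)) (by simp)
      rw [← htel, Matrix.mulVec_sum, Matrix.mulVec_sum, ← Finset.sum_sub_distrib]
      exact Finset.sum_congr rfl fun s _ => by rw [Matrix.mulVecLin_apply, dev2_succ_sub hωL]
    rw [hsum] at h
    set D := ‖∑ s ∈ Finset.Icc 1 K, noise2 G α Δ κ k₀ t₀ y u v s‖
    have hD : 0 ≤ D := norm_nonneg _
    have h1 : ‖(G.avg α - Matrix.vecMulVec (fun _ => 1) ω).mulVec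
            (rescaled G α Δ κ k₀ y u (t₀ + (K + 1)) - rescaled G α Δ κ k₀ y u (t₀ + 1))
          - (α • G.lap).mulVec (∑ s ∈ Finset.Icc 1 K, noise2 G α Δ κ k₀ t₀ y u v s)‖
        ≤ CQ * (2 * Y) + CL * D := by
      refine (norm_sub_le _ _).trans (add_le_add ((hCQ _).trans ?_) (hCL _))
      refine mul_le_mul_of_nonneg_left ((norm_sub_le _ _).trans ?_) hCQ0
      linarith [hresc K, hresc 0]
    calc _ ≤ m / (1 - c) * (2 * R + (CQ * (2 * Y) + CL * D)) := by
          refine h.trans ?_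
          gcongr
          exact le_rfl
      _ ≤ m / (1 - c) * ((2 * R + CQ * (2 * Y) + CL) * (1 + D)) := by
          gcongr
          have : 0 ≤ (2 * R + CQ * (2 * Y)) * D := by positivity
          nlinarith
      _ = m / (1 - c) * (2 * R + CQ * (2 * Y) + CL) * (1 + D) := by ring
      _ ≤ _ := by gcongr; linarith

end Dynamics

/-! ### Unbiasedness and orthogonality of the quantization errors. -/

section Noise

variable {n : ℕ}

lemma measurable_quant (Δ : ℝ) : Measurable fun p : ℝ × ℝ => quant Δ p.1 p.2 := by
  unfold quant
  refine Measurable.ite (measurableSet_lt (by fun_prop) ?_) ?_ ?_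
  · exact (measurable_snd.div_const Δ).sub
      ((measurable_from_top (f := fun z : ℤ => (z : ℝ))).comp
        (Int.measurable_floor.comp (measurable_snd.div_const Δ)))
  · exact ((measurable_from_top (f := fun z : ℤ => (z : ℝ))).comp
        (Int.measurable_ceil.comp (measurable_snd.div_const Δ))).mul_const Δ
  · exact ((measurable_from_top (f := fun z : ℤ => (z : ℝ))).comp
        (Int.measurable_floor.comp (measurable_snd.div_const Δ))).mul_const Δ

lemma Measurable.quant {Ω : Type*} {mΩ : MeasurableSpace Ω} {Δ : ℝ} {Y Z : Ω → ℝ}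
    (hY : Measurable Y) (hZ : Measurable Z) : Measurable fun w => quant Δ (Y w) (Z w) :=
  (measurable_quant Δ).comp (hY.prodMk hZ)

/-- As `r ≥ 0`, rounding up forces a nonzero fractional part, and then the ceiling is the floor plus
one. -/
lemma quant_eq_floor_add_indicator {Δ r : ℝ} (hr : 0 ≤ r) (x : ℝ) :
    quant Δ r x = (⌊x / Δ⌋ + (Set.Iio (Int.fract (x / Δ))).indicator (fun _ => (1 : ℝ)) r) * Δ := by
  have h : x / Δ - ⌊x / Δ⌋ = Int.fract (x / Δ) := rfl
  rw [quant, h, Set.indicator_apply]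
  split_ifs with h1 h2 h2
  · have hne : Int.fract (x / Δ) ≠ 0 := (hr.trans_lt h1).ne'
    have : (⌈x / Δ⌉ : ℝ) = ⌊x / Δ⌋ + 1 := by
      have := Int.ceil_sub_self_eq hne
      have := Int.floor_add_fract (x / Δ)
      linarith
    rw [this]
  · exact absurd h1 h2
  · exact absurd h2 h1
  · rw [add_zero]

/-- The probabilistic quantizer is unbiased. -/
lemma integral_quant {Δ : ℝ} (hΔ : 0 < Δ) (x : ℝ) :
    ∫ r in Set.Ico (0 : ℝ) 1, quant Δ r x = x := by
  rw [setIntegral_congr_fun measurableSet_Ico fun r hr => quant_eq_floor_add_indicator hr.1 x,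
    integral_mul_const, integral_add (by simp) ?_, integral_indicator measurableSet_Iio,
    Measure.restrict_restrict measurableSet_Iio]
  · have hset : Set.Iio (Int.fract (x / Δ)) ∩ Set.Ico (0 : ℝ) 1 = Set.Ico 0 (Int.fract (x / Δ)) := by
      ext r
      have := Int.fract_lt_one (x / Δ)
      simp only [Set.mem_inter_iff, Set.mem_Iio, Set.mem_Ico]
      constructor
      · rintro ⟨h1, h2, _⟩; exact ⟨h2, h1⟩
      · rintro ⟨h1, h2⟩; exact ⟨h2, h1, h2.trans this⟩
    rw [hset]
    simp only [integral_const, smul_eq_mul, mul_one, measureReal_restrict_apply_univ,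
      Real.volume_real_Ico, sub_zero, max_eq_left zero_le_one,
      max_eq_left (Int.fract_nonneg (x / Δ)), one_mul]
    rw [Int.floor_add_fract]
    field_simp
  · exact (integrable_const (1 : ℝ)).indicator measurableSet_Iio

variable {Ω : Type*} [MeasurableSpace Ω] {μ : Measure Ω} [IsProbabilityMeasure μ]

/-- A quantization error is uncorrelated with everything that precedes it. -/
lemma integral_mul_quant_sub_eq_zero {Ω : Type*} {m mΩ : MeasurableSpace Ω} {μ : Measure Ω}
    [IsProbabilityMeasure μ] {Δ : ℝ} (hΔ : 0 < Δ) (hm : m ≤ mΩ)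
    {F Z Y : Ω → ℝ} (hF : Measurable[m] F) (hZ : Measurable[m] Z) (hY : Measurable Y)
    (hYu : μ.map Y = volume.restrict (Set.Ico (0 : ℝ) 1))
    (hind : Indep m (MeasurableSpace.comap Y inferInstance) μ) {B : ℝ} (hB : ∀ w, |F w| ≤ B) :
    ∫ w, F w * (quant Δ (Y w) (Z w) - Z w) ∂μ = 0 := by
  have hFZ : Measurable[m] fun w => (F w, Z w) := hF.prodMk hZ
  have hif : IndepFun (fun w => (F w, Z w)) Y μ := by
    rw [IndepFun_iff_Indep]
    exact indep_of_indep_of_le_left hind hFZ.comap_le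
  have hFZ' : Measurable fun w => (F w, Z w) := hFZ.mono hm le_rfl
  have hmap := hif.map_prod_eq_prod_map_map hFZ'.aemeasurable hY.aemeasurable
  let φ : (ℝ × ℝ) × ℝ → ℝ := fun p => p.1.1 * (quant Δ p.2 p.1.2 - p.1.2)
  have hφ : Measurable φ :=
    (measurable_fst.comp measurable_fst).mul
      ((Measurable.quant measurable_snd (measurable_snd.comp measurable_fst)).sub
        (measurable_snd.comp measurable_fst))
  have hT : Measurable fun w => ((F w, Z w), Y w) := hFZ'.prodMk hY
  have hint : Integrable φ (μ.map fun w => ((F w, Z w), Y w)) := by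
    rw [integrable_map_measure hφ.aestronglyMeasurable hT.aemeasurable]
    refine Integrable.of_bound (hφ.comp hT).aestronglyMeasurable (B * Δ)
      (Eventually.of_forall fun w => ?_)
    simp only [φ, Function.comp_apply, norm_mul, Real.norm_eq_abs]
    exact mul_le_mul (hB w) (abs_quant_sub_le hΔ _ _) (abs_nonneg _)
      ((abs_nonneg _).trans (hB w))
  calc ∫ w, F w * (quant Δ (Y w) (Z w) - Z w) ∂μ
      = ∫ p, φ p ∂(μ.map fun w => ((F w, Z w), Y w)) :=
        (integral_map hT.aemeasurable hφ.aestronglyMeasurable).symm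
    _ = 0 := by
        rw [hmap] at hint ⊢
        have : IsProbabilityMeasure (μ.map Y) := Measure.isProbabilityMeasure_map hY.aemeasurable
        have : IsProbabilityMeasure (μ.map fun w => (F w, Z w)) :=
          Measure.isProbabilityMeasure_map hFZ'.aemeasurable
        -- By independence the joint law is a product; the inner integral over the draw vanishes
        -- because the quantizer is unbiased.
        rw [integral_prod _ hint]
        refine integral_eq_zero_of_ae (Eventually.of_forall fun p => ?_)
        simp only [φ, integral_const_mul, Pi.zero_apply]
        have hq : Integrable (fun y => quant Δ y p.2) (μ.map Y) := by
          have hb : Integrable (fun y => (quant Δ y p.2 - p.2) + p.2) (μ.map Y) := by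
            refine (Integrable.of_bound ?_ Δ
              (Eventually.of_forall fun y => abs_quant_sub_le hΔ y p.2)).add (integrable_const _)
            exact ((Measurable.quant measurable_id measurable_const).sub_const _).aestronglyMeasurable
          simpa using hb
        rw [integral_sub hq (integrable_const _), integral_const, hYu, integral_quant hΔ, ← hYu]
        simp

/-- The second moment of a sum of bounded orthogonal variables. -/
lemma integral_sum_sq_le_of_orthogonal {X : ℕ → Ω → ℝ} (hX : ∀ k, AEStronglyMeasurable (X k) μ)
    {Δ : ℝ} (hb : ∀ k w, |X k w| ≤ Δ) (horth : ∀ k l, k < l → ∫ w, X k w * X l w ∂μ = 0)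
    (s : Finset ℕ) : ∫ w, (∑ k ∈ s, X k w) ^ 2 ∂μ ≤ s.card * Δ ^ 2 := by
  have hint : ∀ k l, Integrable (fun w => X k w * X l w) μ := fun k l =>
    Integrable.of_bound ((hX k).mul (hX l)) (Δ * Δ) (Eventually.of_forall fun w => by
      rw [norm_mul]
      exact mul_le_mul (hb k w) (hb l w) (abs_nonneg _) ((abs_nonneg _).trans (hb k w)))
  have h0 : ∀ k l, k ≠ l → ∫ w, X k w * X l w ∂μ = 0 := fun k l hkl => by
    rcases lt_or_gt_of_ne hkl with h | h
    · exact horth k l h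
    · simp_rw [mul_comm (X k _)]; exact horth l k h
  have h1 : ∀ k, ∫ w, X k w * X k w ∂μ ≤ Δ ^ 2 := fun k => by
    calc ∫ w, X k w * X k w ∂μ ≤ ∫ _, Δ ^ 2 ∂μ :=
          integral_mono (hint k k) (integrable_const _) fun w => by
            change X k w * X k w ≤ Δ ^ 2
            rw [← sq, ← sq_abs]
            exact pow_le_pow_left₀ (abs_nonneg _) (hb k w) 2
      _ = Δ ^ 2 := by simp
  simp_rw [sq (∑ k ∈ s, X k _), Finset.sum_mul_sum]
  rw [integral_finsetSum _ fun k _ => integrable_finsetSum _ fun l _ => hint k l]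
  calc ∑ k ∈ s, ∫ w, ∑ l ∈ s, X k w * X l w ∂μ ≤ ∑ k ∈ s, Δ ^ 2 := by
        refine Finset.sum_le_sum fun k hk => ?_
        rw [integral_finsetSum _ fun l _ => hint k l,
          Finset.sum_eq_single_of_mem k hk fun l _ hlk => h0 k l hlk.symm]
        exact h1 k
    _ = s.card * Δ ^ 2 := by rw [Finset.sum_const, nsmul_eq_mul]

/-- Applied with `S` a set of draws containing the past and `p` the current draw. -/
lemma iIndepFun.indep_iSup_comap {Ω ι : Type*} [MeasurableSpace Ω] {μ : Measure Ω}
    {ξ : ι → Ω → ℝ} (hξm : ∀ p, Measurable (ξ p)) (hξi : iIndepFun ξ μ) {S : Set ι} {p : ι} (hp : p ∉ S) :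
    Indep (⨆ q ∈ S, MeasurableSpace.comap (ξ q) inferInstance)
      (MeasurableSpace.comap (ξ p) inferInstance) μ := by
  have h := indep_iSup_of_disjoint (fun q => (hξm q).comap_le) hξi.iIndep
    (Set.disjoint_singleton_right.2 hp)
  simpa using h

end Noise

/-! ### Adaptedness of the two stages to the draws. -/

section Measurability

variable {n : ℕ} {Ω : Type*} {mΩ : MeasurableSpace Ω} (G : WeightedDigraph n) (α Δ κ : ℝ)

/-- Only draws before time `t` have to be measurable, so the σ-algebra may be the one generated by
the past. -/
lemma measurable_stage1 {u : Ω → ℕ → Fin n → Fin n → ℝ} (t : ℕ)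
    (hu : ∀ s < t, ∀ i j, Measurable fun w => u w s i j) (i j : Fin n) :
    Measurable fun w => stage1 G α Δ κ (u w) t i j := by
  induction t generalizing i j with
  | zero => simp only [stage1]; exact measurable_const
  | succ t ih =>
    have ih' := ih fun s hs => hu s (hs.trans t.lt_succ_self)
    have hq : ∀ l, Measurable fun w => quant Δ (u w t l j) (stage1 G α Δ κ (u w) t l j) :=
      fun l => Measurable.quant (hu t t.lt_succ_self l j) (ih' l j)
    simp only [stage1]
    exact (ih' i j).add ((Finset.measurable_sum _ fun l _ =>
      ((hq l).sub (hq i)).const_mul _).const_mul _)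

lemma measurable_noise1 {u : Ω → ℕ → Fin n → Fin n → ℝ} (t : ℕ)
    (hu : ∀ s ≤ t, ∀ i j, Measurable fun w => u w s i j) (i j : Fin n) :
    Measurable fun w => noise1 G α Δ κ (u w) t j i := by
  have h := measurable_stage1 G α Δ κ t (fun s hs => hu s hs.le) i j
  exact (Measurable.quant (hu t le_rfl i j) h).sub h

variable (k₀ t₀ : ℕ) (y : Fin n → ℝ) {u : Ω → ℕ → Fin n → Fin n → ℝ}
  {v : Ω → ℕ → Fin n → ℝ} (hu : ∀ s i j, Measurable fun w => u w s i j)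

include hu in
lemma measurable_zbar (K : ℕ) (i j : Fin n) :
    Measurable fun w => zbar G α Δ κ k₀ (u w) K i j :=
  (Finset.measurable_sum _ fun _ _ =>
    measurable_stage1 G α Δ κ _ (fun s _ => hu s) i j).const_mul _

include hu in
lemma measurable_corr (t : ℕ) (i : Fin n) :
    Measurable fun w => corr G α Δ κ k₀ t₀ y (u w) t i := by
  have hz := fun K => measurable_zbar G α Δ κ k₀ hu K i i
  unfold corr
  split_ifs
  · exact (((hz _).const_div _).sub_const _).mul_const _
  · exact (((hz _).const_div _).sub ((hz _).const_div _)).mul_const _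

-- Here all first-stage draws are required: the correction at time `t` involves `z̄(t + 1)`, an
-- average over first-stage times up to `k₀ + t + 1`.
include hu in
lemma measurable_stage2 (s : ℕ) (hv : ∀ r < t₀ + s, ∀ i, Measurable fun w => v w r i)
    (i : Fin n) : Measurable fun w => stage2 G α Δ κ k₀ t₀ y (u w) (v w) s i := by
  induction s generalizing i with
  | zero => simp only [stage2]; exact measurable_const
  | succ s ih =>
    have hx : ∀ l, Measurable fun w => xhat G α Δ κ k₀ t₀ y (u w) (v w) s l := fun l =>
      (ih (fun r hr => hv r (by omega)) l).add (measurable_corr G α Δ κ k₀ t₀ y hu _ l)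
    have hq : ∀ l, Measurable fun w =>
        quant Δ (v w (t₀ + s) l) (xhat G α Δ κ k₀ t₀ y (u w) (v w) s l) :=
      fun l => Measurable.quant (hv _ (by omega) l) (hx l)
    exact (hx i).add ((Finset.measurable_sum _ fun l _ =>
      ((hq l).sub (hq i)).const_mul _).const_mul _)

include hu in
lemma measurable_xhat (s : ℕ) (hv : ∀ r < t₀ + s, ∀ i, Measurable fun w => v w r i)
    (i : Fin n) : Measurable fun w => xhat G α Δ κ k₀ t₀ y (u w) (v w) s i :=
  (measurable_stage2 G α Δ κ k₀ t₀ y hu s hv i).add (measurable_corr G α Δ κ k₀ t₀ y hu _ i)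

include hu in
lemma measurable_noise2 (s : ℕ) (hv : ∀ r ≤ t₀ + s, ∀ i, Measurable fun w => v w r i)
    (i : Fin n) : Measurable fun w => noise2 G α Δ κ k₀ t₀ y (u w) (v w) s i := by
  have h := measurable_xhat G α Δ κ k₀ t₀ y hu s (fun r hr => hv r hr.le) i
  exact (Measurable.quant (hv _ le_rfl i) h).sub h

end Measurability

/-! ### Second moments of summed quantization errors. -/

section SecondMoments

variable {n : ℕ} {Ω : Type*} [MeasurableSpace Ω] {μ : Measure Ω} [IsProbabilityMeasure μ]
  {ξ : ℕ × ((Fin n × Fin n) ⊕ Fin n) → Ω → ℝ} (hξm : ∀ p, Measurable (ξ p))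
  (hξu : ∀ p, μ.map (ξ p) = volume.restrict (Set.Ico (0 : ℝ) 1)) (hξi : iIndepFun ξ μ)

include hξm hξu hξi

lemma integral_sum_noise1_sq_le (G : WeightedDigraph n) (α κ : ℝ) {Δ : ℝ} (hΔ : 0 < Δ)
    (i j : Fin n) (s : Finset ℕ) :
    ∫ w, (∑ k ∈ s, noise1 G α Δ κ (fun t i j => ξ (t, Sum.inl (i, j)) w) k j i) ^ 2 ∂μ
      ≤ s.card * Δ ^ 2 := by
  refine integral_sum_sq_le_of_orthogonal
    (X := fun k w => noise1 G α Δ κ (fun t i j => ξ (t, Sum.inl (i, j)) w) k j i)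
    (fun k => (measurable_noise1 G α Δ κ k (fun s _ i j => hξm _) i j).aestronglyMeasurable)
    (fun k w => abs_quant_sub_le hΔ _ _) (fun k l hkl => ?_) s
  let S : Set (ℕ × ((Fin n × Fin n) ⊕ Fin n)) := {p | p.1 < l}
  have hS : ∀ q ∈ S, Measurable[⨆ q ∈ S, MeasurableSpace.comap (ξ q) inferInstance] (ξ q) :=
    fun q hq => (comap_measurable (ξ q)).mono
      (le_iSup₂_of_le (f := fun q (_ : q ∈ S) => MeasurableSpace.comap (ξ q) inferInstance)
        q hq le_rfl) le_rfl
  refine integral_mul_quant_sub_eq_zero hΔ (iSup₂_le fun q _ => (hξm q).comap_le) ?_ ?_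
    (hξm (l, Sum.inl (i, j))) (hξu _)
    (iIndepFun.indep_iSup_comap hξm hξi (S := S) (by simp [S]))
    (fun w => abs_quant_sub_le hΔ _ _)
  · exact @measurable_noise1 n Ω (⨆ q ∈ S, MeasurableSpace.comap (ξ q) inferInstance) G α Δ κ _ k
      (fun r hr i j => hS _ (lt_of_le_of_lt hr hkl)) i j
  · exact @measurable_stage1 n Ω (⨆ q ∈ S, MeasurableSpace.comap (ξ q) inferInstance) G α Δ κ _ l
      (fun r hr i j => hS _ hr) i j

lemma integral_sum_noise2_sq_le (G : WeightedDigraph n) (α κ : ℝ) {Δ : ℝ} (hΔ : 0 < Δ)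
    (k₀ t₀ : ℕ) (y : Fin n → ℝ) (i : Fin n) (s : Finset ℕ) :
    ∫ w, (∑ k ∈ s, noise2 G α Δ κ k₀ t₀ y (fun t i j => ξ (t, Sum.inl (i, j)) w)
      (fun t i => ξ (t, Sum.inr i) w) k i) ^ 2 ∂μ ≤ s.card * Δ ^ 2 := by
  refine integral_sum_sq_le_of_orthogonal
    (X := fun k w => noise2 G α Δ κ k₀ t₀ y (fun t i j => ξ (t, Sum.inl (i, j)) w)
      (fun t i => ξ (t, Sum.inr i) w) k i)
    (fun k => (measurable_noise2 G α Δ κ k₀ t₀ y (fun s i j => hξm _) k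
      (fun r _ i => hξm _) i).aestronglyMeasurable)
    (fun k w => abs_quant_sub_le hΔ _ _) (fun k l hkl => ?_) s
  -- The past of a second-stage draw includes the entire first stage, whatever the times, which
  -- independence of the stages permits.
  let S : Set (ℕ × ((Fin n × Fin n) ⊕ Fin n)) := {p | p.2.isLeft ∨ p.1 < t₀ + l}
  have hS : ∀ q ∈ S, Measurable[⨆ q ∈ S, MeasurableSpace.comap (ξ q) inferInstance] (ξ q) :=
    fun q hq => (comap_measurable (ξ q)).mono
      (le_iSup₂_of_le (f := fun q (_ : q ∈ S) => MeasurableSpace.comap (ξ q) inferInstance)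
        q hq le_rfl) le_rfl
  refine integral_mul_quant_sub_eq_zero hΔ (iSup₂_le fun q _ => (hξm q).comap_le) ?_ ?_
    (hξm (t₀ + l, Sum.inr i)) (hξu _)
    (iIndepFun.indep_iSup_comap hξm hξi (S := S) (by simp [S]))
    (fun w => abs_quant_sub_le hΔ _ _)
  · exact @measurable_noise2 n Ω (⨆ q ∈ S, MeasurableSpace.comap (ξ q) inferInstance) G α Δ κ
      k₀ t₀ y _ _ (fun s i j => hS _ (Or.inl rfl)) k (fun r hr i => hS _ (Or.inr (by
        change r < t₀ + l; omega))) i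
  · exact @measurable_xhat n Ω (⨆ q ∈ S, MeasurableSpace.comap (ξ q) inferInstance) G α Δ κ
      k₀ t₀ y _ _ (fun s i j => hS _ (Or.inl rfl)) l (fun r hr i => hS _ (Or.inr hr)) i

end SecondMoments

/-! ### From pathwise bounds to moment bounds. -/

section MomentBounds

variable {Ω : Type*} [MeasurableSpace Ω] {μ : Measure Ω}

lemma norm_sq_le_sum_sq {ι : Type*} [Fintype ι] (x : ι → ℝ) : ‖x‖ ^ 2 ≤ ∑ i, x i ^ 2 := by
  have h0 : 0 ≤ ∑ i, x i ^ 2 := Finset.sum_nonneg fun i _ => sq_nonneg _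
  rw [← Real.le_sqrt (norm_nonneg _) h0]
  exact (pi_norm_le_iff_of_nonneg (Real.sqrt_nonneg _)).2 fun i => Real.abs_le_sqrt
    (Finset.single_le_sum (f := fun i => x i ^ 2) (fun i _ => sq_nonneg _) (Finset.mem_univ i))

lemma integral_sq_le_of_norm_le [IsProbabilityMeasure μ] {ι : Type*} [Fintype ι] {f : Ω → ℝ}
    {D : Ω → ι → ℝ} {C V : ℝ} (hf : ∀ᵐ w ∂μ, |f w| ≤ C * (1 + ‖D w‖))
    (hD : ∀ i, Integrable (fun w => D w i ^ 2) μ) (hV : ∀ i, ∫ w, D w i ^ 2 ∂μ ≤ V) :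
    ∫ w, f w ^ 2 ∂μ ≤ 2 * C ^ 2 * (1 + Fintype.card ι * V) := by
  have hsum : Integrable (fun w => ∑ i, D w i ^ 2) μ := integrable_finsetSum _ fun i _ => hD i
  calc ∫ w, f w ^ 2 ∂μ ≤ ∫ w, 2 * C ^ 2 * (1 + ∑ i, D w i ^ 2) ∂μ := by
        refine integral_mono_of_nonneg (Eventually.of_forall fun w => sq_nonneg _)
          (((integrable_const _).add hsum).const_mul _) ?_
        filter_upwards [hf] with w hw
        have h1 : f w ^ 2 ≤ (C * (1 + ‖D w‖)) ^ 2 := by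
          rw [← sq_abs]; exact pow_le_pow_left₀ (abs_nonneg _) hw 2
        have h2 := norm_sq_le_sum_sq (D w)
        have h3 : (1 + ‖D w‖) ^ 2 ≤ 2 * (1 + ∑ i, D w i ^ 2) := by
          nlinarith [sq_nonneg (1 - ‖D w‖)]
        nlinarith [mul_le_mul_of_nonneg_left h3 (sq_nonneg C)]
    _ = 2 * C ^ 2 * (1 + ∑ i, ∫ w, D w i ^ 2 ∂μ) := by
        rw [integral_const_mul, integral_add (integrable_const _) hsum,
          integral_finsetSum _ fun i _ => hD i]
        simp
    _ ≤ _ := by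
        gcongr
        calc ∑ i, ∫ w, D w i ^ 2 ∂μ ≤ ∑ _i : ι, V := Finset.sum_le_sum fun i _ => hV i
          _ = _ := by simp

lemma sum_inv_sqrt_le (K : ℕ) :
    ∑ s ∈ Finset.Icc 1 K, 1 / Real.sqrt (s : ℝ) ≤ 2 * Real.sqrt K := by
  induction K with
  | zero => simp
  | succ K ih =>
    rw [Finset.sum_Icc_succ_top (by omega)]
    push_cast
    have ha : 0 ≤ Real.sqrt (K : ℝ) := Real.sqrt_nonneg _
    have hb : 0 < Real.sqrt ((K : ℝ) + 1) := Real.sqrt_pos.2 (by positivity)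
    have ha2 := Real.sq_sqrt (by positivity : (0 : ℝ) ≤ K)
    have hb2 := Real.sq_sqrt (by positivity : (0 : ℝ) ≤ K + 1)
    have : 1 / Real.sqrt ((K : ℝ) + 1) ≤ 2 * (Real.sqrt ((K : ℝ) + 1) - Real.sqrt K) := by
      rw [div_le_iff₀ hb]
      nlinarith [sq_nonneg (Real.sqrt ((K : ℝ) + 1) - Real.sqrt K)]
    linarith

/-- If the second moments decay like `1/s`, those of the partial sums grow at most linearly. -/
lemma integral_sum_sq_le_of_decay {b : ℕ → Ω → ℝ} {A : ℝ}
    (hb : ∀ s, 1 ≤ s → Integrable (fun w => b s w ^ 2) μ)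
    (hA : ∀ s, 1 ≤ s → ∫ w, b s w ^ 2 ∂μ ≤ A / s) (K : ℕ) :
    ∫ w, (∑ s ∈ Finset.Icc 1 K, b s w) ^ 2 ∂μ ≤ 4 * A * K := by
  have hA0 : 0 ≤ A := by
    have h1 := hA 1 le_rfl
    have h2 : 0 ≤ ∫ w, b 1 w ^ 2 ∂μ := integral_nonneg fun w => sq_nonneg _
    simp only [Nat.cast_one, div_one] at h1
    linarith
  set σ := ∑ s ∈ Finset.Icc 1 K, 1 / Real.sqrt (s : ℝ)
  have hσ0 : 0 ≤ σ := Finset.sum_nonneg fun s _ => by positivity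
  have hint : ∀ s ∈ Finset.Icc 1 K, Integrable (fun w => Real.sqrt s * b s w ^ 2) μ :=
    fun s hs => (hb s (Finset.mem_Icc.1 hs).1).const_mul _
  calc ∫ w, (∑ s ∈ Finset.Icc 1 K, b s w) ^ 2 ∂μ
      ≤ ∫ w, σ * ∑ s ∈ Finset.Icc 1 K, Real.sqrt s * b s w ^ 2 ∂μ := by
        refine integral_mono_of_nonneg (Eventually.of_forall fun w => sq_nonneg _)
          ((integrable_finsetSum _ hint).const_mul _) (Eventually.of_forall fun w => ?_)
        -- Cauchy-Schwarz for `b s = s^(-1/4) * (s^(1/4) * b s)`. In expectation the second factor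
        -- is at most `A σ`, and `σ ≤ 2√K`.
        refine Finset.sum_sq_le_sum_mul_sum_of_sq_le_mul _ (fun s _ => by positivity)
          (fun s _ => by positivity) fun s hs => le_of_eq ?_
        have : Real.sqrt (s : ℝ) ≠ 0 := by
          have := (Finset.mem_Icc.1 hs).1
          exact (Real.sqrt_pos.2 (by positivity)).ne'
        field_simp
    _ = σ * ∑ s ∈ Finset.Icc 1 K, Real.sqrt s * ∫ w, b s w ^ 2 ∂μ := by
        rw [integral_const_mul, integral_finsetSum _ hint]
        simp_rw [integral_const_mul]
    _ ≤ σ * ∑ s ∈ Finset.Icc 1 K, A * (1 / Real.sqrt s) := by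
        refine mul_le_mul_of_nonneg_left (Finset.sum_le_sum fun s hs => ?_) hσ0
        refine (mul_le_mul_of_nonneg_left (hA s (Finset.mem_Icc.1 hs).1)
          (Real.sqrt_nonneg _)).trans (le_of_eq ?_)
        rw [← Real.sqrt_div_self']; ring
    _ = A * (σ * σ) := by rw [← Finset.mul_sum]; ring
    _ ≤ A * ((2 * Real.sqrt K) * (2 * Real.sqrt K)) := by
        gcongr <;> exact sum_inv_sqrt_le K
    _ = 4 * A * K := by
        have := Real.mul_self_sqrt (by positivity : (0 : ℝ) ≤ K)
        linear_combination 4 * A * this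

end MomentBounds

section MemLpNoise

variable {n : ℕ} {Ω : Type*} [MeasurableSpace Ω] {μ : Measure Ω} [IsProbabilityMeasure μ]
  (G : WeightedDigraph n) (α κ : ℝ) {Δ : ℝ} (hΔ : 0 < Δ) {u : Ω → ℕ → Fin n → Fin n → ℝ}
  (hu : ∀ s i j, Measurable fun w => u w s i j)

include hΔ hu

lemma memLp_noise1 (t : ℕ) (i j : Fin n) :
    MemLp (fun w => noise1 G α Δ κ (u w) t j i) 2 μ :=
  MemLp.of_bound (measurable_noise1 G α Δ κ t (fun s _ => hu s) i j).aestronglyMeasurable Δ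
    (Eventually.of_forall fun w =>
      (norm_le_pi_norm (noise1 G α Δ κ (u w) t j) i).trans (norm_noise1_le G α κ hΔ (u w) t j))

lemma memLp_noise2 {v : Ω → ℕ → Fin n → ℝ} (hv : ∀ r i, Measurable fun w => v w r i)
    (k₀ t₀ : ℕ) (y : Fin n → ℝ) (s : ℕ) (i : Fin n) :
    MemLp (fun w => noise2 G α Δ κ k₀ t₀ y (u w) (v w) s i) 2 μ :=
  MemLp.of_bound
    (measurable_noise2 G α Δ κ k₀ t₀ y hu s (fun r _ => hv r) i).aestronglyMeasurable Δ
    (Eventually.of_forall fun w => (norm_le_pi_norm (noise2 G α Δ κ k₀ t₀ y (u w) (v w) s) i).trans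
      (norm_noise2_le G α κ hΔ k₀ t₀ y (u w) (v w) s))

end MemLpNoise

/-! ### The mean square error of the running average. -/

section Estimate

variable {n : ℕ} {Ω : Type*} [MeasurableSpace Ω] {μ : Measure Ω} [IsProbabilityMeasure μ]
  {ξ : ℕ × ((Fin n × Fin n) ⊕ Fin n) → Ω → ℝ} (hξm : ∀ p, Measurable (ξ p))
  {G : WeightedDigraph n} {ω : Fin n → ℝ} {α Δ κ η : ℝ} {m : ℕ} {c : ℝ}
  {k₀ t₀ : ℕ} {y : Fin n → ℝ}
  {u : Ω → ℕ → Fin n → Fin n → ℝ} (hu : u = fun w t i j => ξ (t, Sum.inl (i, j)) w)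
  {v : Ω → ℕ → Fin n → ℝ} (hv : v = fun w t i => ξ (t, Sum.inr i) w)
  (hω : ∀ i, 0 < ω i) (hP : PowContracts (Matrix.mulVecLin (G.avg α)) (perp ω) m c)
  (hωL : Matrix.vecMul ω G.lap = 0) (hω1 : ∑ i, ω i = 1) (hΔ : 0 < Δ) (hη : 0 < η)
  (hwell : ∀ᵐ w ∂μ, ∀ t, t₀ + 1 ≤ t → ∀ i,
    η * ω i ≤ zbar G α Δ κ k₀ (u w) t i i / (n : ℝ) ^ κ)

include hξm hu hv hω hP hωL hω1 hΔ hη hwell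

lemma memLp_stage2 (s : ℕ) (i : Fin n) :
    MemLp (fun w => stage2 G α Δ κ k₀ t₀ y (u w) (v w) s i) 2 μ := by
  cases s with
  | zero => simp only [stage2]; exact memLp_const _
  | succ s =>
    obtain ⟨C, -, hC⟩ := exists_stage2_le hω hP hωL hω1 hΔ κ hη k₀ t₀ y
    refine MemLp.of_bound (Measurable.aestronglyMeasurable ?_) C ?_
    · refine measurable_stage2 G α Δ κ k₀ t₀ y (fun s i j => ?_) (s + 1) (fun r _ i => ?_) i
      · rw [hu]; exact hξm _
      · rw [hv]; exact hξm _
    · filter_upwards [hwell] with w hw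
      exact (norm_le_pi_norm _ i).trans ((hC (u w) (v w) hw).1 s)

lemma memLp_xbar (K : ℕ) (i : Fin n) :
    MemLp (fun w => xbar G α Δ κ k₀ t₀ y (u w) (v w) K i) 2 μ :=
  (memLp_finsetSum _ fun s _ =>
    memLp_stage2 hξm hu hv hω hP hωL hω1 hΔ hη hwell s i).const_mul _

variable (hξu : ∀ p, μ.map (ξ p) = volume.restrict (Set.Ico (0 : ℝ) 1)) (hξi : iIndepFun ξ μ)

include hξu hξi

/-- The pathwise bound reduces this to the summed second-stage errors, whose components have second
moment at most `KΔ²`. -/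
lemma exists_integral_sum_dev2_sq_le : ∃ C : ℝ, ∀ i, ∀ K : ℕ, 1 ≤ K →
    ∫ w, (∑ s ∈ Finset.Icc 1 K, dev2 G α Δ κ k₀ t₀ y ω (u w) (v w) s i) ^ 2 ∂μ ≤ C * K := by
  obtain ⟨C, hC0, hC⟩ := exists_stage2_le hω hP hωL hω1 hΔ κ hη k₀ t₀ y
  refine ⟨2 * C ^ 2 * (1 + n * Δ ^ 2), fun i K hK => ?_⟩
  have hK' : (1 : ℝ) ≤ K := by exact_mod_cast hK
  refine (integral_sq_le_of_norm_le (C := C) (V := K * Δ ^ 2)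
    (D := fun w => ∑ s ∈ Finset.Icc 1 K, noise2 G α Δ κ k₀ t₀ y (u w) (v w) s) ?_
    (fun i => ?_) fun i => ?_).trans ?_
  · filter_upwards [hwell] with w hw
    rw [← Finset.sum_apply]
    exact (norm_le_pi_norm _ i).trans ((hC (u w) (v w) hw).2 K)
  · simp_rw [Finset.sum_apply]
    exact (memLp_finsetSum _ fun s _ => memLp_noise2 G α κ hΔ
      (fun s i j => by rw [hu]; exact hξm _) (fun r i => by rw [hv]; exact hξm _)
      k₀ t₀ y s i).integrable_sq
  · simp_rw [Finset.sum_apply, hu, hv]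
    have h := integral_sum_noise2_sq_le hξm hξu hξi G α κ hΔ k₀ t₀ y i (Finset.Icc 1 K)
    simpa using h
  · rw [Fintype.card_fin, mul_assoc (2 * C ^ 2)]
    gcongr
    nlinarith

-- The `ω`-average is a function of the first stage alone. Its error is at most `B / t` times one
-- plus the norm of a sum of `t` orthogonal errors, where `t = t₀ + s ≥ s`.
omit hv in
lemma exists_integral_weighted_stage2_sq_le : ∃ A : ℝ, ∀ s : ℕ, 1 ≤ s →
    ∫ w, (∑ i, ω i * stage2 G α Δ κ k₀ t₀ y (u w) (v w) s i - sampleMean y) ^ 2 ∂μ ≤ A / s := by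
  obtain ⟨C, hC0, hC⟩ := exists_sum_dev1_le hP hωL hω1 hΔ κ k₀
  let d : Fin n → ℝ := fun i => |y i| / (n * η * ω i * (n : ℝ) ^ κ)
  have hd : ∀ i, 0 ≤ d i := fun i => by have := hω i; simp only [d]; positivity
  set B : ℝ := C * ∑ i, d i
  refine ⟨2 * B ^ 2 * (1 + Fintype.card (Fin n × Fin n) * Δ ^ 2), fun s hs => ?_⟩
  obtain ⟨r, rfl⟩ := Nat.exists_eq_add_of_le' hs
  set t : ℕ := t₀ + (r + 1) with ht
  have ht1 : (1 : ℝ) ≤ t := by exact_mod_cast (by omega : 1 ≤ t)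
  have ht0 : (0 : ℝ) < t := by linarith
  refine (integral_sq_le_of_norm_le (C := B / t) (V := t * Δ ^ 2)
    (D := fun w (p : Fin n × Fin n) =>
      ∑ k ∈ Finset.Icc 1 t, noise1 G α Δ κ (u w) (k₀ + k) p.2 p.1) ?_ (fun p => ?_)
      fun p => ?_).trans ?_
  · filter_upwards [hwell] with w hw
    rw [weighted_stage2 hωL]
    refine (weighted_rescaled_sub_le hω hη (hw _ (by omega))).trans ?_
    set D : Fin n × Fin n → ℝ :=
      fun p => ∑ k ∈ Finset.Icc 1 t, noise1 G α Δ κ (u w) (k₀ + k) p.2 p.1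
    have hz : ∀ i, |zbar G α Δ κ k₀ (u w) t i i - (n : ℝ) ^ κ * ω i| ≤ C / t * (1 + ‖D‖) :=
      fun i => by
        rw [zbar_sub_eq G α Δ κ k₀ ω (u w) (by omega), abs_mul, abs_of_pos (by positivity)]
        have h1 := (norm_le_pi_norm _ i).trans (hC (u w) t i)
        have h2 : ‖∑ k ∈ Finset.Icc 1 t, noise1 G α Δ κ (u w) (k₀ + k) i‖ ≤ ‖D‖ :=
          (pi_norm_le_iff_of_nonneg (norm_nonneg _)).2 fun l => by
            rw [Finset.sum_apply]; exact norm_le_pi_norm D (l, i)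
        calc _ ≤ 1 / (t : ℝ) * (C * (1 + ‖D‖)) := by
              refine mul_le_mul_of_nonneg_left (h1.trans ?_) (by positivity)
              gcongr
          _ = _ := by ring
    calc _ ≤ ∑ i, d i * (C / t * (1 + ‖D‖)) :=
          Finset.sum_le_sum fun i _ => mul_le_mul_of_nonneg_left (hz i) (hd i)
      _ = B / t * (1 + ‖D‖) := by rw [← Finset.sum_mul]; ring
  · exact (memLp_finsetSum _ fun k _ => memLp_noise1 G α κ hΔ
      (fun s i j => by rw [hu]; exact hξm _) (k₀ + k) p.1 p.2).integrable_sq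
  · have h := integral_sum_noise1_sq_le hξm hξu hξi G α κ hΔ p.1 p.2
      -- The averages run over the times `k₀ + 1, …, k₀ + t`.
      (Finset.image (fun k => k₀ + k) (Finset.Icc 1 t))
    have hinj : Function.Injective fun k => k₀ + k := fun a b h => by simpa using h
    rw [Finset.card_image_of_injective _ hinj, Nat.card_Icc, Nat.add_sub_cancel] at h
    simp_rw [Finset.sum_image hinj.injOn] at h
    rw [hu]
    exact h
  · set N : ℝ := (Fintype.card (Fin n × Fin n) : ℝ)
    have hst : ((r + 1 : ℕ) : ℝ) ≤ t := by exact_mod_cast (by omega : r + 1 ≤ t)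
    have hN : 0 ≤ N := Nat.cast_nonneg _
    calc 2 * (B / t) ^ 2 * (1 + N * (t * Δ ^ 2))
        ≤ 2 * (B / t) ^ 2 * (t + N * (t * Δ ^ 2)) := by gcongr
      _ = 2 * B ^ 2 * (1 + N * Δ ^ 2) / t := by field_simp
      _ ≤ _ := by gcongr

/-- The mean square error of the running average is of order `1/K`: the Cauchy-Schwarz inequality
with the weights `√s` saves the logarithm that Jensen's inequality would give. -/
lemma exists_integral_xbar_sub_sq_le : ∃ C : ℝ, ∀ i, ∀ K : ℕ, 1 ≤ K →
    ∫ w, (xbar G α Δ κ k₀ t₀ y (u w) (v w) K i - sampleMean y) ^ 2 ∂μ ≤ C / K := by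
  obtain ⟨C, hC⟩ := exists_integral_sum_dev2_sq_le (y := y) hξm hu hv hω hP hωL hω1 hΔ hη hwell
    hξu hξi
  obtain ⟨A, hA⟩ := exists_integral_weighted_stage2_sq_le (y := y) (v := v) hξm hu hω hP
    hωL hω1 hΔ hη hwell hξu hξi
  have hmem := memLp_stage2 (y := y) hξm hu hv hω hP hωL hω1 hΔ hη hwell
  have hmean : ∀ s, MemLp (fun w =>
      ∑ l, ω l * stage2 G α Δ κ k₀ t₀ y (u w) (v w) s l) 2 μ := fun s =>
    memLp_finsetSum _ fun l _ => (hmem s l).const_mul _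
  have hb : ∀ s, MemLp (fun w =>
      ∑ l, ω l * stage2 G α Δ κ k₀ t₀ y (u w) (v w) s l - sampleMean y) 2 μ := fun s =>
    (hmean s).sub (memLp_const _)
  -- The error is `(F + H) / K`, with `F` the summed deviations and `H` the summed errors of the
  -- `ω`-average. Then `(F + H)² ≤ 2F² + 2H²`, with second moments at most `CK` and `4AK`.
  refine ⟨2 * C + 8 * A, fun i K hK => ?_⟩
  have hK0 : (0 : ℝ) < K := by exact_mod_cast hK
  set F : Ω → ℝ := fun w => ∑ s ∈ Finset.Icc 1 K, dev2 G α Δ κ k₀ t₀ y ω (u w) (v w) s i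
  set H : Ω → ℝ := fun w => ∑ s ∈ Finset.Icc 1 K,
    (∑ l, ω l * stage2 G α Δ κ k₀ t₀ y (u w) (v w) s l - sampleMean y)
  have hF : MemLp F 2 μ := memLp_finsetSum _ fun s _ => (hmem s i).sub (hmean s)
  have hH : MemLp H 2 μ := memLp_finsetSum _ fun s _ => hb s
  have hF2 : ∫ w, F w ^ 2 ∂μ ≤ C * K := hC i K hK
  have hH2 : ∫ w, H w ^ 2 ∂μ ≤ 4 * A * K :=
    integral_sum_sq_le_of_decay (fun s _ => (hb s).integrable_sq) hA K
  have heq : ∀ w, xbar G α Δ κ k₀ t₀ y (u w) (v w) K i - sampleMean y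
      = 1 / (K : ℝ) * (F w + H w) := fun w => by
    simp only [xbar, F, H, dev2, ← Finset.sum_add_distrib, sub_add_sub_cancel]
    rw [Finset.sum_sub_distrib, Finset.sum_const, Nat.card_Icc, nsmul_eq_mul,
      Nat.add_sub_cancel]
    field_simp
  calc ∫ w, (xbar G α Δ κ k₀ t₀ y (u w) (v w) K i - sampleMean y) ^ 2 ∂μ
      ≤ ∫ w, (1 / (K : ℝ)) ^ 2 * (2 * F w ^ 2 + 2 * H w ^ 2) ∂μ := by
        refine integral_mono_of_nonneg (Eventually.of_forall fun w => sq_nonneg _)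
          (((hF.integrable_sq.const_mul 2).add (hH.integrable_sq.const_mul 2)).const_mul _)
          (Eventually.of_forall fun w => ?_)
        simp only [heq, mul_pow]
        gcongr
        nlinarith [sq_nonneg (F w - H w)]
    _ = (1 / (K : ℝ)) ^ 2 * (2 * ∫ w, F w ^ 2 ∂μ + 2 * ∫ w, H w ^ 2 ∂μ) := by
        rw [integral_const_mul, integral_add (hF.integrable_sq.const_mul 2)
          (hH.integrable_sq.const_mul 2), integral_const_mul, integral_const_mul]
    _ ≤ (1 / (K : ℝ)) ^ 2 * (2 * (C * K) + 2 * (4 * A * K)) := by gcongr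
    _ = (2 * C + 8 * A) / K := by field_simp; ring

end Estimate

lemma rateConst_nonneg {n : ℕ} (G : WeightedDigraph n) (α Δ η : ℝ) (ω y : Fin n → ℝ) :
    0 ≤ rateConst G α Δ η ω y := by
  unfold rateConst; positivity

lemma const_div_isLittleO_log_div (C : ℝ) :
    (fun K : ℕ => C / (K : ℝ)) =o[atTop] fun K : ℕ => Real.log K / K := by
  have h1 : (fun _ : ℕ => C) =o[atTop] fun K : ℕ => Real.log K :=
    isLittleO_const_left.2 (Or.inr
      (tendsto_norm_atTop_atTop.comp (Real.tendsto_log_atTop.comp tendsto_natCast_atTop_atTop)))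
  simpa only [div_eq_mul_inv] using h1.mul_isBigO (isBigO_refl (fun K : ℕ => (K : ℝ)⁻¹) atTop)

end QuantEst

end

theorem theorem4 {n : ℕ} (G : QuantEst.WeightedDigraph n) (hG : G.StronglyConnected)
    -- the normalized left null vector of the Laplacian
    (ω : Fin n → ℝ) (hωL : Matrix.vecMul ω G.lap = 0) (hω1 : ∑ i, ω i = 1)
    -- step size, quantization step, scaling exponent, starting times, observations
    (α : ℝ) (hα : 0 < α) (hαd : ∀ i, α * G.deg i < 1)
    (Δ : ℝ) (hΔ : 0 < Δ) (κ : ℝ) (hκ : 0 ≤ κ) (k₀ t₀ : ℕ) (y : Fin n → ℝ)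
    {Ω : Type*} [MeasurableSpace Ω] (μ : Measure Ω) [IsProbabilityMeasure μ]
    -- one uniform variable for each quantization: at each time, `inl (i, j)` for the `j`-th
    -- component at node `i` in the first stage, `inr i` for node `i` in the second stage;
    -- independent over times, nodes, components and stages
    (ξ : ℕ × ((Fin n × Fin n) ⊕ Fin n) → Ω → ℝ)
    (hξm : ∀ p, Measurable (ξ p))
    (hξu : ∀ p, μ.map (ξ p) = volume.restrict (Set.Ico (0 : ℝ) 1))
    (hξi : iIndepFun ξ μ)
    (u : Ω → ℕ → Fin n → Fin n → ℝ) (hu : u = fun w t i j => ξ (t, Sum.inl (i, j)) w)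
    (v : Ω → ℕ → Fin n → ℝ) (hv : v = fun w t i => ξ (t, Sum.inr i) w)
    -- well-definedness of the correction terms
    (η : ℝ) (hη0 : 0 < η) (hη1 : η < 1)
    (hwell : ∀ᵐ w ∂μ, ∀ t, t₀ + 1 ≤ t → ∀ i,
      η * ω i ≤ QuantEst.zbar G α Δ κ k₀ (u w) t i i / (n : ℝ) ^ κ) :
    (∀ i K, MemLp (fun w => QuantEst.xbar G α Δ κ k₀ t₀ y (u w) (v w) K i) 2 μ) ∧
    (∀ i, Tendsto (fun K : ℕ =>
        ∫ w, (QuantEst.xbar G α Δ κ k₀ t₀ y (u w) (v w) K i - QuantEst.sampleMean y) ^ 2 ∂μ)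
      atTop (𝓝 0)) ∧
    ∃ r : ℕ → ℝ, r =o[atTop] (fun K : ℕ => Real.log K / K) ∧
      ∀ᶠ K : ℕ in atTop,
        ∫ w, ‖WithLp.toLp 2 (fun i => QuantEst.xbar G α Δ κ k₀ t₀ y (u w) (v w) K i
            - QuantEst.sampleMean y)‖ ^ 2 ∂μ
          ≤ QuantEst.rateConst G α Δ η ω y * (Real.log K / K) + r K := by

  obtain ⟨hω, m, c, hP⟩ := QuantEst.WeightedDigraph.pos_and_powContracts hG hωL hω1 hα hαd
  have hmem := QuantEst.memLp_xbar (y := y) hξm hu hv hω hP hωL hω1 hΔ hη0 hwell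
  obtain ⟨C, hC⟩ := QuantEst.exists_integral_xbar_sub_sq_le (y := y) hξm hu hv hω hP hωL hω1 hΔ
    hη0 hwell hξu hξi
  -- The remainder is the full bound, summed over the `n` components; the nonnegative leading term
  -- is simply added.
  refine ⟨fun i K => hmem K i, fun i => ?_, fun K => n * C / K,
    QuantEst.const_div_isLittleO_log_div _, ?_⟩
  · refine squeeze_zero' (Eventually.of_forall fun K => integral_nonneg fun w => sq_nonneg _)
      ((eventually_ge_atTop 1).mono (hC i)) (tendsto_const_div_atTop_nhds_zero_nat C)
  · filter_upwards [eventually_ge_atTop 1] with K hK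
    have hint : ∀ i, Integrable (fun w =>
        (QuantEst.xbar G α Δ κ k₀ t₀ y (u w) (v w) K i - QuantEst.sampleMean y) ^ 2) μ :=
      fun i => ((hmem K i).sub (memLp_const _)).integrable_sq
    have hlog : 0 ≤ Real.log K / K := div_nonneg (Real.log_natCast_nonneg K) (Nat.cast_nonneg K)
    have hrate := mul_nonneg (QuantEst.rateConst_nonneg G α Δ η ω y) hlog
    simp only [EuclideanSpace.norm_sq_eq, Real.norm_eq_abs, sq_abs]
    rw [integral_finsetSum _ fun i _ => hint i]
    calc _ ≤ ∑ _i : Fin n, C / K := Finset.sum_le_sum fun i _ => hC i K hK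
      _ = n * C / K := by simp [mul_div_assoc]
      _ ≤ _ := by linarith
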